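/- Let $n\ge 3$, let $f\in C^2(\mathbb{R})$, and let $S_{0,\min}\le S_{0,\max}<0$ be real numbers such that $f$ is strictly decreasing on $[S_{0,\min},S_{0,\max}]$ in the sense that $f'(x)<0$ for all $x\in[S_{0,\min},S_{0,\max}]$. Then there are constants $B,C,c>0$, depending only on $n$, $f$, $S_{0,\min}$ and $S_{0,\max}$, with the following property. Let $(M,g_0)$ be a compact smooth Riemannian manifold without boundary of dimension $n$ whose scalar curvature $S_0$ satisfies $\min_M S_0=S_{0,\min}$ and $\max_M S_0=S_{0,\max}$ (so $S_0$ is everywhere negative). Let $\alpha\in(0,1)$, $T\in(0,\infty]$, and let $u>0$ on $[0,T)\times M$ be a solution of class $C^{2+\alpha}([0,T)\times M)$ of the generalized Yamabe flow with $u_0=1$, i.e. the metrics $g(t)=u(t)^{\frac{4}{n-2}}g_0$ satisfy $$\partial_t g=(f(S)-A)\,g,\qquad g(0)=g_0,\qquad A(t)=\mathrm{Vol}_{g(t)}(M)^{-1}\int_M f(S)\,d\mathrm{Vol}_{g(t)},$$ where $S=S(t)$ is the scalar curvature of $g(t)$. Then for all $t\in[0,T)$ $$\|f(S(t))-A(t)\|_{L^\infty(M)}\le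 C e^{-Bt}\qquad\text{and}\qquad c^{-1}\le u(t,p)\le c\quad\text{for all }p\in M.$$ In particular $B$, $C$ and $c$ are independent of $T$. Here $u\in C^{2+\alpha}([0,T)\times M)$ means that for each $\tau\in[0,T)$ the function $u$ is $C^2$ in the space variable on $[0,\tau]\times M$, and $u$, $\Delta_0u$ and $\partial_tu$ (one-sided at the end points) are continuous, bounded and $\alpha$-Hölder on $[0,\tau]\times M$ with respect to the parabolic distance $\sqrt{d(p,q)^2+|t-s|}$, where $\Delta_0$ and $d$ are the Laplacian and the Riemannian distance of $g_0$. -/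

import Mathlib

open Set MeasureTheory Manifold Bundle
open scoped Manifold ContDiff ENNReal

namespace YamabeFlow

universe u

/-! ### Riemannian geometry in coordinates on `ℝⁿ` -/

section Coordinates

variable {n : ℕ}

/-- The partial derivative `∂ᵢ F` at `y`. -/
noncomputable def partialDeriv (i : Fin n) (F : EuclideanSpace ℝ (Fin n) → ℝ)
    (y : EuclideanSpace ℝ (Fin n)) : ℝ :=
  fderiv ℝ F y (EuclideanSpace.single i 1)

/-- Christoffel symbols of a metric given by its coefficient matrix `G = (g_{ij})`:
`Γ^k_{ij} = ½ ∑_l g^{kl} (∂ᵢ g_{jl} + ∂ⱼ g_{il} - ∂_l g_{ij})`. -/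
noncomputable def christoffel (G : EuclideanSpace ℝ (Fin n) → Matrix (Fin n) (Fin n) ℝ)
    (k i j : Fin n) (y : EuclideanSpace ℝ (Fin n)) : ℝ :=
  (1 / 2) * ∑ l, (G y)⁻¹ k l *
    (partialDeriv i (fun z => G z j l) y + partialDeriv j (fun z => G z i l) y
      - partialDeriv l (fun z => G z i j) y)

/-- Ricci curvature in coordinates:
`R_{ij} = ∑_k (∂_k Γ^k_{ij} - ∂ⱼ Γ^k_{ik}) + ∑_{k,l} (Γ^k_{kl} Γ^l_{ij} - Γ^k_{jl} Γ^l_{ik})`. -/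
noncomputable def ricciCoord (G : EuclideanSpace ℝ (Fin n) → Matrix (Fin n) (Fin n) ℝ)
    (i j : Fin n) (y : EuclideanSpace ℝ (Fin n)) : ℝ :=
  ∑ k, (partialDeriv k (christoffel G k i j) y - partialDeriv j (christoffel G k i k) y)
    + ∑ k, ∑ l, (christoffel G k k l y * christoffel G l i j y
        - christoffel G k j l y * christoffel G l i k y)

/-- Scalar curvature in coordinates: `∑_{i,j} g^{ij} R_{ij}` (round spheres have positive scalar
curvature). -/
noncomputable def scalarCoord (G : EuclideanSpace ℝ (Fin n) → Matrix (Fin n) (Fin n) ℝ)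
    (y : EuclideanSpace ℝ (Fin n)) : ℝ :=
  ∑ i, ∑ j, (G y)⁻¹ i j * ricciCoord G i j y

/-- Laplace-Beltrami operator in coordinates:
`Δ F = ∑_{i,j} g^{ij} (∂ᵢ ∂ⱼ F - ∑_k Γ^k_{ij} ∂_k F)`. -/
noncomputable def laplaceCoord (G : EuclideanSpace ℝ (Fin n) → Matrix (Fin n) (Fin n) ℝ)
    (F : EuclideanSpace ℝ (Fin n) → ℝ) (y : EuclideanSpace ℝ (Fin n)) : ℝ :=
  ∑ i, ∑ j, (G y)⁻¹ i j *
    (partialDeriv i (partialDeriv j F) y - ∑ k, christoffel G k i j y * partialDeriv k F y)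

end Coordinates

/-! ### Riemannian geometry on a manifold -/

/-- A field of bilinear forms on the tangent spaces of an `n`-dimensional manifold. -/
abbrev BilinField (n : ℕ) (M : Type u) [TopologicalSpace M]
    [ChartedSpace (EuclideanSpace ℝ (Fin n)) M] : Type u :=
  ∀ x : M, TangentSpace (𝓡 n) x →L[ℝ] TangentSpace (𝓡 n) x →L[ℝ] ℝ

/-- A smooth Riemannian metric. -/
abbrev SmoothMetric (n : ℕ) (M : Type u) [TopologicalSpace M]
    [ChartedSpace (EuclideanSpace ℝ (Fin n)) M] [IsManifold (𝓡 n) ∞ M] : Type u :=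
  ContMDiffRiemannianMetric (𝓡 n) ∞ (EuclideanSpace ℝ (Fin n))
    (fun x : M => TangentSpace (𝓡 n) x)

section Manifold

variable {n : ℕ} {M : Type u} [TopologicalSpace M] [ChartedSpace (EuclideanSpace ℝ (Fin n)) M]

/-- The coefficients `g_{ij} = g(∂ᵢ, ∂ⱼ)` of `g` in the preferred chart around `x₀`, as functions of
the coordinates; the coordinate vector field `∂ᵢ` is the image of the `i`-th standard basis vector
under the derivative of the inverse chart. -/
noncomputable def metricMatrix (g : BilinField n M) (x₀ : M) (y : EuclideanSpace ℝ (Fin n)) :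
    Matrix (Fin n) (Fin n) ℝ :=
  Matrix.of fun i j =>
    g ((extChartAt (𝓡 n) x₀).symm y)
      (mfderiv (𝓡 n) (𝓡 n) (extChartAt (𝓡 n) x₀).symm y
        (EuclideanSpace.single i (1 : ℝ) : EuclideanSpace ℝ (Fin n)))
      (mfderiv (𝓡 n) (𝓡 n) (extChartAt (𝓡 n) x₀).symm y
        (EuclideanSpace.single j (1 : ℝ) : EuclideanSpace ℝ (Fin n)))

/-- The scalar curvature of `g` at `p`, computed in the preferred chart around `p`. -/
noncomputable def scalarCurvature (g : BilinField n M) (p : M) : ℝ :=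
  scalarCoord (metricMatrix g p) (extChartAt (𝓡 n) p p)

/-- The Laplace-Beltrami operator of `g` applied to `w` at `p`, computed in the preferred chart
around `p`. -/
noncomputable def laplacian (g : BilinField n M) (w : M → ℝ) (p : M) : ℝ :=
  laplaceCoord (metricMatrix g p) (w ∘ (extChartAt (𝓡 n) p).symm) (extChartAt (𝓡 n) p p)

/-- The conformal metric `φ^{4/(n-2)} g`. -/
noncomputable def conformal (φ : M → ℝ) (g : BilinField n M) : BilinField n M :=
  fun x => (φ x ^ (4 / ((n : ℝ) - 2))) • g x

/-- A smooth partition of unity indexed by the points of the manifold, the function with index `x`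
being supported in the domain of the preferred chart around `x`. -/
noncomputable def chartPartition (n : ℕ) (M : Type u) [TopologicalSpace M]
    [ChartedSpace (EuclideanSpace ℝ (Fin n)) M] [IsManifold (𝓡 n) ∞ M] [T2Space M]
    [SigmaCompactSpace M] : SmoothPartitionOfUnity M (𝓡 n) M univ :=
  (SmoothPartitionOfUnity.exists_isSubordinate_chartAt_source (𝓡 n) M).choose

/-- The Riemannian volume measure of `g`, that is
`∫ h dVol_g = ∑ₓ ∫ (ρₓ h)(φₓ⁻¹ y) √(det g_{ij}(y)) dy` for a partition of unity `ρₓ` subordinate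
to charts `φₓ`. -/
noncomputable def volumeMeasure [MeasurableSpace M] [IsManifold (𝓡 n) ∞ M] [T2Space M]
    [SigmaCompactSpace M] (g : BilinField n M) : Measure M :=
  Measure.sum fun x : M =>
    (((volume : Measure (EuclideanSpace ℝ (Fin n))).restrict (extChartAt (𝓡 n) x).target).withDensity
      fun y => ENNReal.ofReal (chartPartition n M x ((extChartAt (𝓡 n) x).symm y) *
        √(metricMatrix g x y).det)).map (extChartAt (𝓡 n) x).symm

/-- The Riemannian distance of a smooth metric (infinite between different components). -/
noncomputable def riemDist [IsManifold (𝓡 n) ∞ M] (g : SmoothMetric n M) (p q : M) : ℝ≥0∞ :=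
  letI : RiemannianBundle (fun x : M => TangentSpace (𝓡 n) x) := ⟨g.toRiemannianMetric⟩
  riemannianEDist (𝓡 n) p q

/-- The parabolic distance `√(d(p,q)² + |t - s|)`. -/
noncomputable def parabolicDist [IsManifold (𝓡 n) ∞ M] (g : SmoothMetric n M)
    (t : ℝ) (p : M) (s : ℝ) (q : M) : ℝ≥0∞ :=
  (riemDist g p q ^ 2 + ENNReal.ofReal |t - s|) ^ (1 / 2 : ℝ)

/-- Membership in the parabolic Hölder space `C^α([0,τ] × M)`. -/
def MemHolder [IsManifold (𝓡 n) ∞ M] (g : SmoothMetric n M) (α τ : ℝ) (w : ℝ → M → ℝ) : Prop :=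
  ContinuousOn (fun z : ℝ × M => w z.1 z.2) (Icc 0 τ ×ˢ univ) ∧
  ∃ K : ℝ, (∀ t ∈ Icc 0 τ, ∀ p, |w t p| ≤ K) ∧
    ∀ t ∈ Icc 0 τ, ∀ s ∈ Icc 0 τ, ∀ p q,
      ENNReal.ofReal |w t p - w s q| ≤ ENNReal.ofReal K * parabolicDist g t p s q ^ α

/-- Membership in the parabolic Hölder space `C^{2+α}([0,τ] × M)`: the function `w` is `C²` in
space, and `w`, `Δ w` and `∂ₜ w` (one-sided at the end points) all lie in `C^α([0,τ] × M)`. -/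
def MemHolder2 [IsManifold (𝓡 n) ∞ M] (g : SmoothMetric n M) (α τ : ℝ) (w : ℝ → M → ℝ) : Prop :=
  (∀ t ∈ Icc 0 τ, ContMDiff (𝓡 n) 𝓘(ℝ, ℝ) 2 (w t)) ∧
  MemHolder g α τ w ∧
  MemHolder g α τ (fun t => laplacian g.inner (w t)) ∧
  ∃ w' : ℝ → M → ℝ, MemHolder g α τ w' ∧
    ∀ t ∈ Icc 0 τ, ∀ p, HasDerivWithinAt (fun s => w s p) (w' t p) (Icc 0 τ) t

/-- The average `A = Vol_g⁻¹ ∫ f(S) dVol_g`, where `S` is the scalar curvature of `g`. -/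
noncomputable def averageCurvature [MeasurableSpace M] [IsManifold (𝓡 n) ∞ M] [T2Space M]
    [SigmaCompactSpace M] (f : ℝ → ℝ) (g : BilinField n M) : ℝ :=
  ⨍ p, f (scalarCurvature g p) ∂(volumeMeasure g)

/-- The time interval `[0,T)`, where `T = ∞` is allowed. -/
def timeInterval (T : EReal) : Set ℝ := {t : ℝ | 0 ≤ t ∧ (t : EReal) < T}

/-- `u > 0` is a solution on `[0,T)`, in the class `C^{2+α}([0,T) × M)`, of the generalized Yamabe
flow `∂ₜ g = (f(S) - A) g` for `g(t) = u(t)^{4/(n-2)} g₀`, with `u(0) = 1`. -/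
structure IsYamabeSolution [MeasurableSpace M] [IsManifold (𝓡 n) ∞ M] [T2Space M]
    [SigmaCompactSpace M] (f : ℝ → ℝ) (g₀ : SmoothMetric n M) (α : ℝ) (T : EReal)
    (u : ℝ → M → ℝ) : Prop where
  regular : ∀ τ ∈ timeInterval T, MemHolder2 g₀ α τ u
  pos : ∀ t ∈ timeInterval T, ∀ p, 0 < u t p
  initial : ∀ p, u 0 p = 1
  flow : ∀ t ∈ timeInterval T, ∀ p, ∀ v w : TangentSpace (𝓡 n) p,
    HasDerivWithinAt (fun s => conformal (u s) g₀.inner p v w)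
      ((f (scalarCurvature (conformal (u t) g₀.inner) p)
          - averageCurvature f (conformal (u t) g₀.inner))
        * conformal (u t) g₀.inner p v w) (timeInterval T) t

end Manifold

end YamabeFlow

/-!
Write `w = 4/(n-2) log u`, so that `g(t) = e^w g₀` and the flow reads `∂ₜw = f(S) - A`.

The conformal transformation law `IsMetricAt.scalarCoord_exp_smul`, rewritten as the Yamabe
equation `scalarCurvature_conformal`, together with the sign of the Laplacian at a minimum, gives
a comparison between two times `t`, `t'`: at a point where `w(t') - w(t)` is largest, `S(t') ≥
e^{-(w(t') - w(t))} S(t)` (`rpow_mul_scalarCurvature_le`). As long as `S` is negative this says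
that `σ + w` does not increase there, where `σ = log (-S)`. In terms of `σ` the flow is `∂ₜw =
F(σ) - A` with `F(σ) = f(-e^σ)`, and `F` is increasing with slope `f'(x) x` at `x = -e^σ`, which
is bounded below by a positive constant `B` on the initial range of the curvature.

So the difference quotients of `w` in time satisfy a maximum principle (`le_of_deriv_le_at_max`):
where the increment of `w` is largest, `F(σ)` decreases at least `B` times as much as `w`
increases, and likewise with the signs reversed. Since the average `A` lies between the extrema of
`f(S)`, the largest increment is nonnegative and the smallest is nonpositive up to an error
`o(h)`. Hence the extrema of `f(S)` are monotone, so `S` never leaves its initial range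
(`CurvatureFlow.mem_Icc`), and the oscillation of `f(S)` decays like `e^{-Bt}`
(`MonotoneFlow.osc_le`). Working with difference quotients avoids differentiating the curvature in
time, for which the regularity of `u` would not suffice. Integrating `∂ₜw` bounds `w`, hence `u`,
uniformly in time (`abs_le_of_abs_deriv_le_exp`).

Two facts about the initial metric and the volume enter. The curvature of `g(t)` is continuous in
space and time once `S₀` is; the continuity of `S₀` is read off from the flow equation at time
zero, because `f(S₀) - A(0)` is continuous and `f` is injective on the range of `S₀`
(`IsYamabeSolution.continuous_initial`). The volume measure is finite and nonzero, so that the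
average lies between the extrema (`exists_averageCurvature_le_and_ge`).
-/

namespace YamabeFlow

universe u

section Coordinates

open Finset Topology Filter
open scoped MatrixOrder

variable {n : ℕ}
local notation "E" => EuclideanSpace ℝ (Fin n)

/-! ### Calculus of partial derivatives -/

theorem partialDeriv_add {i : Fin n} {F H : E → ℝ} {y : E} (hF : DifferentiableAt ℝ F y)
    (hH : DifferentiableAt ℝ H y) :
    partialDeriv i (fun z => F z + H z) y = partialDeriv i F y + partialDeriv i H y := by
  simp only [partialDeriv, fderiv_fun_add hF hH, add_apply]

theorem partialDeriv_sub {i : Fin n} {F H : E → ℝ} {y : E} (hF : DifferentiableAt ℝ F y)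
    (hH : DifferentiableAt ℝ H y) :
    partialDeriv i (fun z => F z - H z) y = partialDeriv i F y - partialDeriv i H y := by
  simp only [partialDeriv, fderiv_fun_sub hF hH, sub_apply]

theorem partialDeriv_mul {i : Fin n} {F H : E → ℝ} {y : E} (hF : DifferentiableAt ℝ F y)
    (hH : DifferentiableAt ℝ H y) :
    partialDeriv i (fun z => F z * H z) y
      = partialDeriv i F y * H y + F y * partialDeriv i H y := by
  simp only [partialDeriv, fderiv_fun_mul hF hH, add_apply,
    smul_apply, smul_eq_mul]
  ring

theorem partialDeriv_const_mul {i : Fin n} {F : E → ℝ} {y : E} (c : ℝ)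
    (hF : DifferentiableAt ℝ F y) :
    partialDeriv i (fun z => c * F z) y = c * partialDeriv i F y := by
  simp only [partialDeriv, fderiv_const_mul hF, smul_apply, smul_eq_mul]

theorem partialDeriv_sum {ι : Type*} {s : Finset ι} {i : Fin n} {F : ι → E → ℝ} {y : E}
    (hF : ∀ a ∈ s, DifferentiableAt ℝ (F a) y) :
    partialDeriv i (fun z => ∑ a ∈ s, F a z) y = ∑ a ∈ s, partialDeriv i (F a) y := by
  simp only [partialDeriv, fderiv_fun_sum hF, _root_.sum_apply]

theorem partialDeriv_congr {i : Fin n} {F H : E → ℝ} {y : E} (h : F =ᶠ[𝓝 y] H) :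
    partialDeriv i F y = partialDeriv i H y := by
  simp only [partialDeriv, h.fderiv_eq]

theorem partialDeriv_comp {i : Fin n} {F : E → ℝ} {q : ℝ → ℝ} {q' : ℝ} {y : E}
    (hq : HasDerivAt q q' (F y)) (hF : DifferentiableAt ℝ F y) :
    partialDeriv i (fun z => q (F z)) y = q' * partialDeriv i F y := by
  have h := hq.comp_hasFDerivAt y hF.hasFDerivAt
  have h' : fderiv ℝ (fun z => q (F z)) y = q' • fderiv ℝ F y := h.fderiv
  simp only [partialDeriv, h', smul_apply, smul_eq_mul]

theorem differentiableAt_partialDeriv {i : Fin n} {F : E → ℝ} {y : E}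
    (hF : ContDiffAt ℝ 2 F y) : DifferentiableAt ℝ (partialDeriv i F) y := by
  have h : DifferentiableAt ℝ (fderiv ℝ F) y :=
    (hF.fderiv_right (m := 1) (by norm_num)).differentiableAt (by norm_num)
  exact h.clm_apply (differentiableAt_const _)

theorem eventually_differentiableAt {F : E → ℝ} {y : E} (hF : ContDiffAt ℝ 2 F y) :
    ∀ᶠ z in 𝓝 y, DifferentiableAt ℝ F z := by
  filter_upwards [hF.eventually (by simp)] with z hz using hz.differentiableAt (by norm_num)

/-! ### The conformal change of the scalar curvature: algebra -/

/-- The difference of the Christoffel symbols of `e^{2ψ} g` and of `g`, as a function of the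
coefficients `γ = g_{ij}`, of `p = ∂ψ` and of the gradient `v`, `v^k = g^{kl} ∂_l ψ`. -/
def conformalTensor (γ : Matrix (Fin n) (Fin n) ℝ) (p v : Fin n → ℝ) (k i j : Fin n) : ℝ :=
  (if k = i then p j else 0) + (if k = j then p i else 0) - γ i j * v k

theorem conformalTensor_comm {γ : Matrix (Fin n) (Fin n) ℝ} (hγ : γ.IsSymm) (p v : Fin n → ℝ)
    (k i j : Fin n) : conformalTensor γ p v k i j = conformalTensor γ p v k j i := by
  simp only [conformalTensor, hγ.apply i j]
  ring

section Algebra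

variable {γ h : Matrix (Fin n) (Fin n) ℝ} {p v : Fin n → ℝ}

theorem sum_conformalTensor_self (hv : ∀ i, ∑ k, γ i k * v k = p i) (hγ : γ.IsSymm) (i : Fin n) :
    ∑ k, conformalTensor γ p v k k i = n * p i := by
  simp only [conformalTensor, sum_add_distrib, sum_sub_distrib, if_true, sum_const, card_univ,
    Fintype.card_fin, nsmul_eq_mul, sum_ite_eq', Finset.mem_univ, hγ.apply i, hv]
  ring

theorem sum_mul_conformalTensor (hh : h.IsSymm) (hp : ∀ k, ∑ l, h k l * p l = v k)
    (hgh : ∑ i, ∑ j, h i j * γ i j = n) (k : Fin n) :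
    ∑ i, ∑ j, h i j * conformalTensor γ p v k i j = (2 - n) * v k := by
  have h1 : ∑ i, ∑ j, h i j * (if k = i then p j else 0) = v k := by
    simp [← hp]
  have h2 : ∑ i, ∑ j, h i j * (if k = j then p i else 0) = v k := by
    simp [← hp, hh.apply k]
  have h3 : ∑ i, ∑ j, h i j * (γ i j * v k) = n * v k := by
    simp only [← hgh, sum_mul, mul_assoc]
  simp only [conformalTensor, mul_add, mul_sub, sum_add_distrib, sum_sub_distrib, h1, h2, h3]
  ring

theorem sum_contract (hp : ∀ k, ∑ l, h k l * p l = v k) (a : Fin n → ℝ) :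
    ∑ i, ∑ j, h i j * (a i * p j) = ∑ i, a i * v i := by
  simp only [← hp, mul_sum]
  exact sum_congr rfl fun i _ => sum_congr rfl fun j _ => by ring

theorem sum_contract' (hh : h.IsSymm) (hp : ∀ k, ∑ l, h k l * p l = v k) (a : Fin n → ℝ) :
    ∑ i, ∑ j, h i j * (p i * a j) = ∑ i, a i * v i := by
  rw [sum_comm, ← sum_contract hp]
  exact sum_congr rfl fun i _ => sum_congr rfl fun j _ => by rw [hh.apply]; ring

/-- The contraction with `g^{ij}` of the part of the Ricci tensor that is quadratic in the
connection coefficients, polarized. -/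
def quadContraction (h : Matrix (Fin n) (Fin n) ℝ) (X Y : Fin n → Fin n → Fin n → ℝ) : ℝ :=
  ∑ i, ∑ j, h i j * ∑ k, ∑ l, (X k k l * Y l i j - X k j l * Y l i k)

/-- Only the trace `X^k_{kl}` and the contraction of `X` with `p` survive. -/
theorem quadContraction_conformalTensor_right (hh : h.IsSymm)
    (hhγ : ∀ j k, ∑ i, h i j * γ i k = if j = k then 1 else 0)
    (hp : ∀ k, ∑ l, h k l * p l = v k) (hgh : ∑ i, ∑ j, h i j * γ i j = n)
    {X : Fin n → Fin n → Fin n → ℝ} (hX : ∀ k i j, X k i j = X k j i) :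
    quadContraction h X (conformalTensor γ p v)
      = (2 - n) * ∑ l, (∑ k, X k k l) * v l - ∑ i, ∑ j, h i j * ∑ k, p k * X k i j := by
  have e1 : ∀ i j, ∑ k, ∑ l, X k k l * conformalTensor γ p v l i j
      = (∑ k, X k k i) * p j + p i * (∑ k, X k k j) - γ i j * ∑ l, (∑ k, X k k l) * v l := by
    intro i j
    rw [sum_comm]
    simp only [← sum_mul]
    obtain ⟨a, ha⟩ : ∃ a : Fin n → ℝ, ∀ l, ∑ k, X k k l = a l := ⟨_, fun _ => rfl⟩
    simp only [ha]
    simp only [conformalTensor, mul_add, mul_sub, sum_add_distrib, sum_sub_distrib,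
      mul_ite, mul_zero, sum_ite_eq', Finset.mem_univ, if_true, mul_sum]
    congr 1
    · ring
    · exact sum_congr rfl fun l _ => by ring
  have e2 : ∀ i j, ∑ k, ∑ l, X k j l * conformalTensor γ p v l i k
      = ∑ k, p k * X k i j + p i * (∑ k, X k k j) - ∑ k, γ i k * ∑ l, X k j l * v l := by
    intro i j
    simp only [conformalTensor, mul_add, mul_sub, sum_add_distrib, sum_sub_distrib,
      mul_ite, mul_zero, sum_ite_eq', Finset.mem_univ, if_true, mul_sum]
    congr 1
    · congr 1
      · exact sum_congr rfl fun l _ => by rw [hX]; ring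
      · exact sum_congr rfl fun l _ => by rw [hX]; ring
    · exact sum_congr rfl fun k _ => sum_congr rfl fun l _ => by ring
  have e3 : ∑ i, ∑ j, h i j * ∑ k, γ i k * ∑ l, X k j l * v l
      = ∑ l, (∑ k, X k k l) * v l := by
    calc _ = ∑ j, ∑ k, (∑ i, h i j * γ i k) * ∑ l, X k j l * v l := by
          rw [sum_comm]
          refine sum_congr rfl fun j _ => ?_
          simp only [mul_sum, sum_mul]
          rw [sum_comm]
          refine sum_congr rfl fun k _ => ?_
          rw [sum_comm]
          exact sum_congr rfl fun l _ => sum_congr rfl fun i _ => by ring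
      _ = ∑ j, ∑ l, X j j l * v l := by simp [hhγ]
      _ = _ := by rw [sum_comm]; simp only [sum_mul]
  have e4 : ∑ i, ∑ j, h i j * (γ i j * ∑ l, (∑ k, X k k l) * v l)
      = n * ∑ l, (∑ k, X k k l) * v l := by
    rw [← hgh]; simp only [sum_mul, mul_assoc]
  simp only [quadContraction, sum_sub_distrib, e1, e2]
  simp only [mul_sub, mul_add, sum_sub_distrib, sum_add_distrib, e3, e4, sum_contract hp,
    sum_contract' hh hp]
  ring

/-- In this order only the contraction of `X` with `p` survives. -/
theorem quadContraction_conformalTensor_left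
    (hhγ : ∀ i k, ∑ j, h i j * γ j k = if i = k then 1 else 0)
    (hp : ∀ k, ∑ l, h k l * p l = v k) (hT : ∀ i, ∑ k, conformalTensor γ p v k k i = n * p i)
    {X : Fin n → Fin n → Fin n → ℝ} (hX : ∀ k i j, X k i j = X k j i) :
    quadContraction h (conformalTensor γ p v) X
      = (n - 1) * ∑ i, ∑ j, h i j * ∑ k, p k * X k i j := by
  have e1 : ∀ i j, ∑ k, ∑ l, conformalTensor γ p v k k l * X l i j
      = n * ∑ k, p k * X k i j := by
    intro i j
    rw [sum_comm]
    simp only [← sum_mul, hT, mul_sum, mul_assoc]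
  have e2 : ∀ i j, ∑ k, ∑ l, conformalTensor γ p v k j l * X l i k
      = ∑ k, p k * X k i j + (∑ k, X k k i) * p j - ∑ l, γ j l * ∑ k, X l i k * v k := by
    intro i j
    simp only [conformalTensor, add_mul, sub_mul, sum_add_distrib, sum_sub_distrib,
      ite_mul, zero_mul, sum_ite_eq, Finset.mem_univ, if_true, mul_sum, sum_mul]
    congr 1
    · congr 1
      · rw [sum_comm]; simp
      · exact sum_congr rfl fun l _ => by rw [hX]; ring
    · rw [sum_comm]
      exact sum_congr rfl fun k _ => sum_congr rfl fun l _ => by ring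
  have e3 : ∑ i, ∑ j, h i j * ∑ l, γ j l * ∑ k, X l i k * v k
      = ∑ l, (∑ k, X k k l) * v l := by
    calc _ = ∑ i, ∑ l, (∑ j, h i j * γ j l) * ∑ k, X l i k * v k := by
          refine sum_congr rfl fun i _ => ?_
          simp only [mul_sum, sum_mul]
          rw [sum_comm]
          refine sum_congr rfl fun k _ => ?_
          rw [sum_comm]
          exact sum_congr rfl fun l _ => sum_congr rfl fun i _ => by ring
      _ = ∑ j, ∑ l, X j j l * v l := by simp [hhγ]
      _ = _ := by rw [sum_comm]; simp only [sum_mul]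
  have e4 : ∑ i, ∑ j, h i j * (n * ∑ k, p k * X k i j)
      = n * ∑ i, ∑ j, h i j * ∑ k, p k * X k i j := by
    simp only [mul_sum]
    exact sum_congr rfl fun i _ => sum_congr rfl fun j _ => sum_congr rfl fun k _ => by ring
  simp only [quadContraction, sum_sub_distrib, e1, e2]
  simp only [mul_sub, mul_add, sum_sub_distrib, sum_add_distrib, e3, e4, sum_contract hp]
  ring

theorem quadContraction_add (h : Matrix (Fin n) (Fin n) ℝ) (X Y : Fin n → Fin n → Fin n → ℝ) :
    quadContraction h (fun k i j => X k i j + Y k i j) (fun k i j => X k i j + Y k i j)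
      = quadContraction h X X + quadContraction h X Y + quadContraction h Y X
        + quadContraction h Y Y := by
  simp only [quadContraction, ← sum_add_distrib, ← mul_add]
  refine sum_congr rfl fun i _ => sum_congr rfl fun j _ => ?_
  congr 1
  exact sum_congr rfl fun k _ => sum_congr rfl fun l _ => by ring

/-- The contribution of the conformal factor to the quadratic part of the scalar curvature. -/
theorem quadContraction_conformal (hh : h.IsSymm) (hγ : γ.IsSymm) (hhγ : h * γ = 1)
    (hp : ∀ k, ∑ l, h k l * p l = v k) (hv : ∀ i, ∑ k, γ i k * v k = p i)
    {X : Fin n → Fin n → Fin n → ℝ} (hX : ∀ k i j, X k i j = X k j i) :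
    quadContraction h (fun k i j => X k i j + conformalTensor γ p v k i j)
        (fun k i j => X k i j + conformalTensor γ p v k i j)
      = quadContraction h X X + (2 - n) * ∑ l, (∑ k, X k k l) * v l
        + (n - 2) * ∑ i, ∑ j, h i j * ∑ k, p k * X k i j
        + (2 - n) * (n - 1) * ∑ l, p l * v l := by
  have h1 : ∀ i k, ∑ j, h i j * γ j k = if i = k then 1 else 0 := fun i k => by
    rw [← Matrix.one_apply, ← hhγ, Matrix.mul_apply]
  have h2 : ∀ j k, ∑ i, h i j * γ i k = if j = k then 1 else 0 := fun j k => by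
    rw [← h1]; exact sum_congr rfl fun i _ => by rw [hh.apply]
  have h3 : ∑ i, ∑ j, h i j * γ i j = n := by
    have : ∀ i, ∑ j, h i j * γ i j = 1 := fun i => by
      rw [← (h1 i i).trans (if_pos rfl)]
      exact sum_congr rfl fun j _ => by rw [hγ.apply]
    simp [this]
  have hT := sum_conformalTensor_self hv hγ
  have hTs := conformalTensor_comm hγ p v
  have h5 : ∑ i, ∑ j, h i j * ∑ k, p k * conformalTensor γ p v k i j
      = (2 - n) * ∑ l, p l * v l := by
    calc _ = ∑ k, p k * ∑ i, ∑ j, h i j * conformalTensor γ p v k i j := by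
          simp only [mul_sum]
          rw [sum_comm' (t' := univ) (s' := fun _ => univ) (by simp)]
          rw [sum_congr rfl fun i _ => sum_comm, sum_comm]
          rw [sum_congr rfl fun i _ => sum_comm]
          exact sum_congr rfl fun k _ => sum_congr rfl fun i _ => sum_congr rfl fun j _ => by ring
      _ = _ := by
          simp only [sum_mul_conformalTensor hh hp h3, mul_sum]
          exact sum_congr rfl fun k _ => by ring
  rw [quadContraction_add, quadContraction_conformalTensor_right hh h2 hp h3 hX,
    quadContraction_conformalTensor_left h1 hp hT hX,
    quadContraction_conformalTensor_left h1 hp hT hTs, h5]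
  ring

/-- The trace `Γ^k_{kl}` of the Christoffel symbols; `d m i j` stands for `∂_m g_{ij}`. -/
theorem sum_christoffel_self (hh : h.IsSymm) {d : Fin n → Fin n → Fin n → ℝ} (l : Fin n)
    (hd : ∀ m i j, d m i j = d m j i) :
    ∑ k, 1 / 2 * ∑ m, h k m * (d k l m + d l k m - d m k l)
      = 1 / 2 * ∑ i, ∑ j, h i j * d l i j := by
  have : ∑ k, ∑ m, h k m * d k l m = ∑ k, ∑ m, h k m * d m k l := by
    rw [sum_comm]
    exact sum_congr rfl fun i _ => sum_congr rfl fun j _ => by rw [hh.apply, hd]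
  simp only [← mul_sum, mul_add, mul_sub, sum_add_distrib, sum_sub_distrib, this]
  ring

/-- The contraction `g^{ij} p_k Γ^k_{ij}` in terms of the gradient `v` of `p`; `d m i j` stands for
`∂_m g_{ij}`. -/
theorem sum_contract_christoffel (hh : h.IsSymm) (hp : ∀ k, ∑ l, h k l * p l = v k)
    (d : Fin n → Fin n → Fin n → ℝ) :
    ∑ i, ∑ j, h i j * ∑ k, p k * (1 / 2 * ∑ l, h k l * (d i j l + d j i l - d l i j))
      = ∑ i, ∑ j, h i j * ∑ k, d i j k * v k - 1 / 2 * ∑ i, ∑ j, h i j * ∑ k, d k i j * v k := by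
  have e : ∀ i j, ∑ k, p k * (1 / 2 * ∑ l, h k l * (d i j l + d j i l - d l i j))
      = 1 / 2 * (∑ k, d i j k * v k + ∑ k, d j i k * v k - ∑ k, d k i j * v k) := by
    intro i j
    rw [← sum_add_distrib, ← sum_sub_distrib, mul_sum]
    simp only [mul_sum]
    rw [sum_comm]
    refine sum_congr rfl fun l _ => ?_
    rw [← hp]
    simp only [mul_sum, ← sum_add_distrib, ← sum_sub_distrib]
    exact sum_congr rfl fun k _ => by rw [hh.apply]; ring
  have e2 : ∑ i, ∑ j, h i j * ∑ k, d j i k * v k = ∑ i, ∑ j, h i j * ∑ k, d i j k * v k := by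
    rw [sum_comm]
    exact sum_congr rfl fun i _ => sum_congr rfl fun j _ => by rw [hh.apply]
  simp only [e]
  simp only [mul_left_comm _ (1 / 2 : ℝ), ← mul_sum]
  simp only [mul_add, mul_sub, sum_add_distrib, sum_sub_distrib, e2]
  ring

end Algebra

/-! ### The conformal change of the scalar curvature: calculus -/

/-- `G` is the coefficient matrix of a Riemannian metric of class `C²` near `y`. -/
structure IsMetricAt (G : E → Matrix (Fin n) (Fin n) ℝ) (y : E) : Prop where
  contDiffAt : ∀ i j, ContDiffAt ℝ 2 (fun z => G z i j) y
  posDef : ∀ᶠ z in 𝓝 y, (G z).PosDef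

theorem isSymm_of_posDef {A : Matrix (Fin n) (Fin n) ℝ} (hA : A.PosDef) : A.IsSymm := by
  have h := hA.1
  rwa [Matrix.IsHermitian, Matrix.conjTranspose_eq_transpose_of_trivial] at h

theorem isUnit_det_of_posDef {A : Matrix (Fin n) (Fin n) ℝ} (hA : A.PosDef) : IsUnit A.det :=
  isUnit_iff_ne_zero.2 hA.det_pos.ne'

theorem inv_smul_of_posDef {A : Matrix (Fin n) (Fin n) ℝ} (hA : A.PosDef) {c : ℝ} (hc : c ≠ 0) :
    (c • A)⁻¹ = c⁻¹ • A⁻¹ := by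
  refine Matrix.inv_eq_right_inv ?_
  rw [Matrix.smul_mul, Matrix.mul_smul, smul_smul, mul_inv_cancel₀ hc, one_smul,
    Matrix.mul_nonsing_inv _ (isUnit_det_of_posDef hA)]

theorem IsMetricAt.differentiableAt {G : E → Matrix (Fin n) (Fin n) ℝ} {y : E}
    (hG : IsMetricAt G y) (i j : Fin n) : DifferentiableAt ℝ (fun z => G z i j) y :=
  (hG.contDiffAt i j).differentiableAt (by norm_num)

theorem IsMetricAt.differentiableAt_inv {G : E → Matrix (Fin n) (Fin n) ℝ} {y : E}
    (hG : IsMetricAt G y) (i j : Fin n) :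
    DifferentiableAt ℝ (fun z => (G z)⁻¹ i j) y := by
  have hdet : ∀ A : E → Matrix (Fin n) (Fin n) ℝ, (∀ i j, DifferentiableAt ℝ (fun z => A z i j) y) →
      DifferentiableAt ℝ (fun z => (A z).det) y := by
    intro A hA
    simp only [Matrix.det_apply]
    refine DifferentiableAt.fun_sum fun σ _ => DifferentiableAt.const_smul ?_ _
    exact (HasFDerivAt.finsetProd fun i _ => (hA (σ i) i).hasFDerivAt).differentiableAt
  simp only [Matrix.inv_def, Matrix.smul_apply, Ring.inverse_eq_inv', smul_eq_mul,
    Matrix.adjugate_apply]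
  refine ((hdet G hG.differentiableAt).inv hG.posDef.self_of_nhds.det_pos.ne').mul
    (hdet _ fun a b => ?_)
  by_cases ha : a = j
  · subst ha; simp
  · simpa [Matrix.updateRow_ne ha] using hG.differentiableAt a b

theorem IsMetricAt.differentiableAt_christoffel {G : E → Matrix (Fin n) (Fin n) ℝ} {y : E}
    (hG : IsMetricAt G y) (k i j : Fin n) :
    DifferentiableAt ℝ (christoffel G k i j) y := by
  refine DifferentiableAt.const_mul (DifferentiableAt.fun_sum fun l _ => ?_) _
  exact (hG.differentiableAt_inv k l).mul (((differentiableAt_partialDeriv (hG.contDiffAt _ _)).add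
    (differentiableAt_partialDeriv (hG.contDiffAt _ _))).sub
    (differentiableAt_partialDeriv (hG.contDiffAt _ _)))

theorem IsMetricAt.eventually_symm {G : E → Matrix (Fin n) (Fin n) ℝ} {y : E}
    (hG : IsMetricAt G y) : ∀ᶠ z in 𝓝 y, ∀ i j, G z i j = G z j i := by
  filter_upwards [hG.posDef] with z hz i j using (isSymm_of_posDef hz).apply j i

theorem IsMetricAt.inv_symm {G : E → Matrix (Fin n) (Fin n) ℝ} {y : E}
    (hG : IsMetricAt G y) : (G y)⁻¹.IsSymm := by
  have := isSymm_of_posDef hG.posDef.self_of_nhds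
  rw [Matrix.IsSymm, Matrix.transpose_nonsing_inv, this]

theorem IsMetricAt.christoffel_symm {G : E → Matrix (Fin n) (Fin n) ℝ} {y : E}
    (hG : IsMetricAt G y) (k i j : Fin n) :
    christoffel G k i j y = christoffel G k j i y := by
  have : ∀ l, partialDeriv l (fun z => G z i j) y = partialDeriv l (fun z => G z j i) y :=
    fun l => partialDeriv_congr (hG.eventually_symm.mono fun z hz => hz i j)
  simp only [christoffel, this]
  congr 1
  exact sum_congr rfl fun l _ => by ring

/-- The gradient `∇^k ψ = ∑_l g^{kl} ∂_l ψ` in coordinates. -/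
noncomputable def gradCoord (G : E → Matrix (Fin n) (Fin n) ℝ) (ψ : E → ℝ) (z : E)
    (k : Fin n) : ℝ :=
  ∑ l, (G z)⁻¹ k l * partialDeriv l ψ z

/-- The Christoffel symbols of `e^{2ψ} g` differ from those of `g` by the conformal tensor. -/
theorem christoffel_exp_smul {G : E → Matrix (Fin n) (Fin n) ℝ} {z : E} {ψ : E → ℝ}
    (hG : ∀ i j, DifferentiableAt ℝ (fun z => G z i j) z) (hψ : DifferentiableAt ℝ ψ z)
    (hpos : (G z).PosDef) (k i j : Fin n) :
    christoffel (fun z => Real.exp (2 * ψ z) • G z) k i j z = christoffel G k i j z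
      + conformalTensor (G z) (fun l => partialDeriv l ψ z) (gradCoord G ψ z) k i j := by
  have hinv := inv_smul_of_posDef hpos (Real.exp_pos (2 * ψ z)).ne'
  have hmul : ∀ i k, ∑ j, (G z)⁻¹ i j * G z j k = if i = k then 1 else 0 := fun i k => by
    rw [← Matrix.one_apply, ← Matrix.nonsing_inv_mul _ (isUnit_det_of_posDef hpos),
      Matrix.mul_apply]
  have hsymm := isSymm_of_posDef hpos
  have hpd : ∀ a i j, partialDeriv a (fun w => (Real.exp (2 * ψ w) • G w) i j) z
      = Real.exp (2 * ψ z) * (2 * partialDeriv a ψ z * G z i j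
        + partialDeriv a (fun w => G w i j) z) := by
    intro a i j
    simp only [Matrix.smul_apply, smul_eq_mul]
    rw [partialDeriv_mul (by fun_prop) (hG i j),
      partialDeriv_comp (q := fun s => Real.exp (2 * s)) (q' := 2 * Real.exp (2 * ψ z)) _ hψ]
    · ring
    · simpa [mul_comm] using ((hasDerivAt_id (ψ z)).const_mul 2).exp
  simp only [christoffel, hpd, hinv]
  have h1 : ∀ a : Fin n, ∑ l, (G z)⁻¹ k l * G z a l = if k = a then 1 else 0 := fun a => by
    rw [← hmul]; exact sum_congr rfl fun l _ => by rw [hsymm.apply]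
  calc _ = (1 / 2) * ∑ l, ((G z)⁻¹ k l * (partialDeriv i (fun z => G z j l) z
            + partialDeriv j (fun z => G z i l) z - partialDeriv l (fun z => G z i j) z)
          + (2 * partialDeriv i ψ z * ((G z)⁻¹ k l * G z j l)
            + 2 * partialDeriv j ψ z * ((G z)⁻¹ k l * G z i l)
            - 2 * G z i j * ((G z)⁻¹ k l * partialDeriv l ψ z))) := by
        congr 1
        refine sum_congr rfl fun l _ => ?_
        simp only [Matrix.smul_apply, smul_eq_mul]
        field_simp
        ring
    _ = _ := by
        simp only [sum_add_distrib, sum_sub_distrib, ← mul_sum, h1, conformalTensor, gradCoord]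
        split_ifs <;> ring

/-- The scalar curvature split into the part that is linear in the derivatives of the Christoffel
symbols and the part that is quadratic in the symbols. -/
theorem scalarCoord_eq_quadContraction (G : E → Matrix (Fin n) (Fin n) ℝ) (y : E) :
    scalarCoord G y = ∑ i, ∑ j, (G y)⁻¹ i j *
      ∑ k, (partialDeriv k (christoffel G k i j) y - partialDeriv j (christoffel G k i k) y)
      + quadContraction (G y)⁻¹ (fun k i j => christoffel G k i j y)
        (fun k i j => christoffel G k i j y) := by
  simp only [scalarCoord, ricciCoord, quadContraction, mul_add, sum_add_distrib]

theorem partialDeriv_ite {m : Fin n} {c : Prop} [Decidable c] {F : E → ℝ} {y : E} :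
    partialDeriv m (fun z => if c then F z else 0) y = if c then partialDeriv m F y else 0 := by
  split_ifs
  · rfl
  · simp [partialDeriv]

theorem sum_mul_gradCoord {G : E → Matrix (Fin n) (Fin n) ℝ} {z : E} (hz : (G z).PosDef)
    (ψ : E → ℝ) (i : Fin n) : ∑ k, G z i k * gradCoord G ψ z k = partialDeriv i ψ z := by
  have : (G z).mulVec ((G z)⁻¹.mulVec fun l => partialDeriv l ψ z)
      = fun l => partialDeriv l ψ z := by
    rw [Matrix.mulVec_mulVec, Matrix.mul_nonsing_inv _ (isUnit_det_of_posDef hz), Matrix.one_mulVec]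
  exact congrFun this i

theorem IsMetricAt.differentiableAt_gradCoord {G : E → Matrix (Fin n) (Fin n) ℝ} {y : E}
    (hG : IsMetricAt G y) {ψ : E → ℝ} (hψ : ContDiffAt ℝ 2 ψ y) (k : Fin n) :
    DifferentiableAt ℝ (fun z => gradCoord G ψ z k) y :=
  DifferentiableAt.fun_sum fun l _ =>
    (hG.differentiableAt_inv k l).mul (differentiableAt_partialDeriv hψ)

theorem IsMetricAt.sum_inv_mul {G : E → Matrix (Fin n) (Fin n) ℝ} {y : E}
    (hG : IsMetricAt G y) (i k : Fin n) :
    ∑ j, (G y)⁻¹ i j * G y j k = if i = k then 1 else 0 := by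
  rw [← Matrix.one_apply, ← Matrix.nonsing_inv_mul _ (isUnit_det_of_posDef hG.posDef.self_of_nhds),
    Matrix.mul_apply]

/-- The divergence of the gradient as a contraction, without derivatives of the inverse matrix:
differentiate `∑_k g_{ik} ∇^k ψ = ∂_i ψ`. -/
theorem IsMetricAt.sum_partialDeriv_gradCoord {G : E → Matrix (Fin n) (Fin n) ℝ} {y : E}
    (hG : IsMetricAt G y) {ψ : E → ℝ} (hψ : ContDiffAt ℝ 2 ψ y) :
    ∑ i, ∑ j, (G y)⁻¹ i j * ∑ k, partialDeriv i (fun z => G z j k) y * gradCoord G ψ y k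
      + ∑ k, partialDeriv k (fun z => gradCoord G ψ z k) y
      = ∑ i, ∑ j, (G y)⁻¹ i j * partialDeriv i (partialDeriv j ψ) y := by
  have hdiv0 : ∀ m i, partialDeriv m (partialDeriv i ψ) y
      = ∑ k, partialDeriv m (fun z => G z i k) y * gradCoord G ψ y k
        + ∑ k, G y i k * partialDeriv m (fun z => gradCoord G ψ z k) y := by
    intro m i
    rw [← sum_add_distrib,
      ← partialDeriv_congr (hG.posDef.mono fun z hz => sum_mul_gradCoord hz ψ i),
      partialDeriv_sum fun k _ => (hG.differentiableAt i k).fun_mul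
        (hG.differentiableAt_gradCoord hψ k)]
    exact sum_congr rfl fun k _ => partialDeriv_mul (hG.differentiableAt i k)
      (hG.differentiableAt_gradCoord hψ k)
  simp only [hdiv0, mul_add, sum_add_distrib]
  congr 1
  calc _ = ∑ i, ∑ k, (∑ j, (G y)⁻¹ i j * G y j k)
            * partialDeriv i (fun z => gradCoord G ψ z k) y := by
        simp [hG.sum_inv_mul]
    _ = _ := by
        refine sum_congr rfl fun i _ => ?_
        simp only [mul_sum, sum_mul]
        rw [sum_comm]
        exact sum_congr rfl fun j _ => sum_congr rfl fun k _ => by ring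

theorem IsMetricAt.eventually_christoffel_exp_smul {G : E → Matrix (Fin n) (Fin n) ℝ} {y : E}
    (hG : IsMetricAt G y) {ψ : E → ℝ} (hψ : ContDiffAt ℝ 2 ψ y) (k i j : Fin n) :
    ∀ᶠ z in 𝓝 y, christoffel (fun z => Real.exp (2 * ψ z) • G z) k i j z = christoffel G k i j z
      + conformalTensor (G z) (fun l => partialDeriv l ψ z) (gradCoord G ψ z) k i j := by
  have h1 : ∀ᶠ z in 𝓝 y, ∀ i j, DifferentiableAt ℝ (fun z => G z i j) z := by
    simp only [eventually_all]
    exact fun i j => eventually_differentiableAt (hG.contDiffAt i j)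
  filter_upwards [h1, eventually_differentiableAt hψ, hG.posDef] with z hz1 hz2 hz3
  exact christoffel_exp_smul hz1 hz2 hz3 k i j

/-- The part of the Ricci tensor of `e^{2ψ} g` that is linear in the connection coefficients. -/
theorem IsMetricAt.sum_partialDeriv_christoffel_exp_smul {G : E → Matrix (Fin n) (Fin n) ℝ} {y : E}
    (hG : IsMetricAt G y) {ψ : E → ℝ} (hψ : ContDiffAt ℝ 2 ψ y) (i j : Fin n) :
    ∑ k, (partialDeriv k (christoffel (fun z => Real.exp (2 * ψ z) • G z) k i j) y
          - partialDeriv j (christoffel (fun z => Real.exp (2 * ψ z) • G z) k i k) y)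
      = ∑ k, (partialDeriv k (christoffel G k i j) y - partialDeriv j (christoffel G k i k) y)
        + (partialDeriv i (partialDeriv j ψ) y + (1 - n) * partialDeriv j (partialDeriv i ψ) y
          - ∑ k, partialDeriv k (fun z => G z i j) y * gradCoord G ψ y k
          - G y i j * ∑ k, partialDeriv k (fun z => gradCoord G ψ z k) y) := by
  have hdp : ∀ i, DifferentiableAt ℝ (partialDeriv i ψ) y := fun i =>
    differentiableAt_partialDeriv hψ
  have hdv := hG.differentiableAt_gradCoord hψ
  have hi : ∀ (c : Prop) [Decidable c] a,
      DifferentiableAt ℝ (fun z => if c then partialDeriv a ψ z else 0) y := by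
    intro c _ a
    split_ifs
    exacts [hdp a, differentiableAt_const _]
  have hdT : ∀ k i j, DifferentiableAt ℝ (fun z =>
      conformalTensor (G z) (fun l => partialDeriv l ψ z) (gradCoord G ψ z) k i j) y :=
    fun k i j => ((hi _ _).add (hi _ _)).sub ((hG.differentiableAt i j).mul (hdv k))
  have hΓd : ∀ m k i j, partialDeriv m (christoffel (fun z => Real.exp (2 * ψ z) • G z) k i j) y
      = partialDeriv m (christoffel G k i j) y + partialDeriv m (fun z =>
        conformalTensor (G z) (fun l => partialDeriv l ψ z) (gradCoord G ψ z) k i j) y :=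
    fun m k i j => by
      rw [partialDeriv_congr (hG.eventually_christoffel_exp_smul hψ k i j),
        partialDeriv_add (hG.differentiableAt_christoffel k i j) (hdT k i j)]
  have hT1 : ∑ k, partialDeriv k (fun z =>
        conformalTensor (G z) (fun l => partialDeriv l ψ z) (gradCoord G ψ z) k i j) y
      = partialDeriv i (partialDeriv j ψ) y + partialDeriv j (partialDeriv i ψ) y
        - ∑ k, partialDeriv k (fun z => G z i j) y * gradCoord G ψ y k
        - G y i j * ∑ k, partialDeriv k (fun z => gradCoord G ψ z k) y := by
    have : ∀ k, partialDeriv k (fun z =>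
          conformalTensor (G z) (fun l => partialDeriv l ψ z) (gradCoord G ψ z) k i j) y
        = (if k = i then partialDeriv k (partialDeriv j ψ) y else 0)
          + (if k = j then partialDeriv k (partialDeriv i ψ) y else 0)
          - partialDeriv k (fun z => G z i j) y * gradCoord G ψ y k
          - G y i j * partialDeriv k (fun z => gradCoord G ψ z k) y := by
      intro k
      unfold conformalTensor
      rw [partialDeriv_sub ((hi _ _).fun_add (hi _ _)) ((hG.differentiableAt i j).fun_mul (hdv k)),
        partialDeriv_add (hi _ _) (hi _ _), partialDeriv_mul (hG.differentiableAt i j) (hdv k),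
        partialDeriv_ite, partialDeriv_ite]
      ring
    simp only [this, sum_add_distrib, sum_sub_distrib, sum_ite_eq', Finset.mem_univ, if_true,
      ← mul_sum]
  have hT2 : ∑ k, partialDeriv j (fun z =>
        conformalTensor (G z) (fun l => partialDeriv l ψ z) (gradCoord G ψ z) k i k) y
      = n * partialDeriv j (partialDeriv i ψ) y := by
    rw [← partialDeriv_sum fun k _ => hdT k i k, ← partialDeriv_const_mul _ (hdp i)]
    refine partialDeriv_congr ?_
    filter_upwards [hG.posDef] with z hz
    rw [← sum_conformalTensor_self (sum_mul_gradCoord hz ψ) (isSymm_of_posDef hz)]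
    exact sum_congr rfl fun k _ => conformalTensor_comm (isSymm_of_posDef hz) _ _ _ _ _
  simp only [hΓd, sum_add_distrib, sum_sub_distrib, hT1, hT2]
  ring

theorem IsMetricAt.sum_contract_christoffel {G : E → Matrix (Fin n) (Fin n) ℝ} {y : E}
    (hG : IsMetricAt G y) (ψ : E → ℝ) :
    ∑ i, ∑ j, (G y)⁻¹ i j * ∑ k, partialDeriv k ψ y * christoffel G k i j y
      = ∑ i, ∑ j, (G y)⁻¹ i j * ∑ k, partialDeriv i (fun z => G z j k) y * gradCoord G ψ y k
        - 1 / 2 * ∑ i, ∑ j, (G y)⁻¹ i j * ∑ k,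
          partialDeriv k (fun z => G z i j) y * gradCoord G ψ y k := by
  have h := YamabeFlow.sum_contract_christoffel hG.inv_symm
    (p := fun k => partialDeriv k ψ y) (v := gradCoord G ψ y) (fun _ => rfl)
    (fun m i j => partialDeriv m (fun z => G z i j) y)
  beta_reduce at h
  rw [← h]
  rfl

theorem IsMetricAt.sum_christoffel_self_mul {G : E → Matrix (Fin n) (Fin n) ℝ} {y : E}
    (hG : IsMetricAt G y) (ψ : E → ℝ) :
    ∑ l, (∑ k, christoffel G k k l y) * gradCoord G ψ y l
      = 1 / 2 * ∑ i, ∑ j, (G y)⁻¹ i j * ∑ k,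
          partialDeriv k (fun z => G z i j) y * gradCoord G ψ y k := by
  have h1 : ∀ l, ∑ k, christoffel G k k l y
      = 1 / 2 * ∑ i, ∑ j, (G y)⁻¹ i j * partialDeriv l (fun z => G z i j) y := fun l => by
    rw [← sum_christoffel_self hG.inv_symm (d := fun m i j => partialDeriv m (fun z => G z i j) y) l
      fun m i j => partialDeriv_congr (hG.eventually_symm.mono fun z hz => hz i j)]
    rfl
  simp only [h1, mul_sum, sum_mul]
  rw [sum_comm]
  refine sum_congr rfl fun i _ => ?_
  rw [sum_comm]
  exact sum_congr rfl fun j _ => sum_congr rfl fun k _ => by ring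

/-- The conformal transformation law of the scalar curvature:
`S(e^{2ψ} g) = e^{-2ψ} (S(g) - 2(n-1) Δψ - (n-1)(n-2) |∇ψ|²)`. -/
theorem IsMetricAt.scalarCoord_exp_smul {G : E → Matrix (Fin n) (Fin n) ℝ} {y : E}
    (hG : IsMetricAt G y) {ψ : E → ℝ} (hψ : ContDiffAt ℝ 2 ψ y) :
    scalarCoord (fun z => Real.exp (2 * ψ z) • G z) y = (Real.exp (2 * ψ y))⁻¹ *
      (scalarCoord G y - 2 * (n - 1) * laplaceCoord G ψ y
        - (n - 1) * (n - 2) * ∑ k, partialDeriv k ψ y * gradCoord G ψ y k) := by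
  have hpos := hG.posDef.self_of_nhds
  have hsymm := hG.inv_symm
  have hGsymm := isSymm_of_posDef hpos
  have hinvsmul := inv_smul_of_posDef hpos (Real.exp_pos (2 * ψ y)).ne'
  have hscal : scalarCoord (fun z => Real.exp (2 * ψ z) • G z) y = (Real.exp (2 * ψ y))⁻¹ *
      (∑ i, ∑ j, (G y)⁻¹ i j * ∑ k,
        (partialDeriv k (christoffel (fun z => Real.exp (2 * ψ z) • G z) k i j) y
          - partialDeriv j (christoffel (fun z => Real.exp (2 * ψ z) • G z) k i k) y)
        + quadContraction (G y)⁻¹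
          (fun k i j => christoffel (fun z => Real.exp (2 * ψ z) • G z) k i j y)
          (fun k i j => christoffel (fun z => Real.exp (2 * ψ z) • G z) k i j y)) := by
    rw [scalarCoord_eq_quadContraction, hinvsmul, mul_add, mul_sum]
    simp only [quadContraction, Matrix.smul_apply, smul_eq_mul, mul_sum, mul_assoc]
  simp only [hscal, hG.sum_partialDeriv_christoffel_exp_smul hψ,
    (hG.eventually_christoffel_exp_smul hψ _ _ _).self_of_nhds]
  rw [quadContraction_conformal (v := gradCoord G ψ y) hsymm hGsymm
    (Matrix.nonsing_inv_mul _ (isUnit_det_of_posDef hpos))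
    (fun _ => rfl) (sum_mul_gradCoord hpos ψ) (X := fun k i j => christoffel G k i j y)
    (fun k i j => hG.christoffel_symm k i j)]
  have hdiv := hG.sum_partialDeriv_gradCoord hψ
  have hK := hG.sum_contract_christoffel ψ
  have htr := hG.sum_christoffel_self_mul ψ
  have hlap : laplaceCoord G ψ y
      = ∑ i, ∑ j, (G y)⁻¹ i j * partialDeriv i (partialDeriv j ψ) y
        - ∑ i, ∑ j, (G y)⁻¹ i j * ∑ k, partialDeriv k ψ y * christoffel G k i j y := by
    simp only [laplaceCoord, mul_sub, sum_sub_distrib]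
    congr 1
    exact sum_congr rfl fun i _ => sum_congr rfl fun j _ => by
      congr 1; exact sum_congr rfl fun k _ => mul_comm _ _
  rw [htr, hlap, scalarCoord_eq_quadContraction G, hK]
  have hqsymm : ∑ i, ∑ j, (G y)⁻¹ i j * partialDeriv j (partialDeriv i ψ) y
      = ∑ i, ∑ j, (G y)⁻¹ i j * partialDeriv i (partialDeriv j ψ) y := by
    rw [sum_comm]
    exact sum_congr rfl fun i _ => sum_congr rfl fun j _ => by rw [hsymm.apply]
  have hgh : ∑ i, ∑ j, (G y)⁻¹ i j * G y i j = n := by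
    have : ∀ i, ∑ j, (G y)⁻¹ i j * G y i j = 1 := fun i => by
      rw [← (hG.sum_inv_mul i i).trans (if_pos rfl)]
      exact sum_congr rfl fun j _ => by rw [hGsymm.apply]
    simp [this]
  -- once the sums are split, the claim is linear in them and follows from `hdiv`
  generalize hδ : ∑ k, partialDeriv k (fun z => gradCoord G ψ z k) y = δ at *
  have hsplit : ∀ (h R q r Q g : Fin n → Fin n → ℝ),
      ∑ i, ∑ j, h i j * (R i j + (q i j + (1 - n) * r i j - Q i j - g i j * δ))
      = ∑ i, ∑ j, h i j * R i j + ∑ i, ∑ j, h i j * q i j + (1 - n) * ∑ i, ∑ j, h i j * r i j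
        - ∑ i, ∑ j, h i j * Q i j - (∑ i, ∑ j, h i j * g i j) * δ := by
    intro h R q r Q g
    simp only [mul_sum, sum_mul, ← sum_add_distrib, ← sum_sub_distrib]
    exact sum_congr rfl fun i _ => sum_congr rfl fun j _ => by ring
  have hlin := hsplit (fun i j => (G y)⁻¹ i j)
    (fun i j => ∑ k, (partialDeriv k (christoffel G k i j) y
      - partialDeriv j (christoffel G k i k) y))
    (fun i j => partialDeriv i (partialDeriv j ψ) y)
    (fun i j => partialDeriv j (partialDeriv i ψ) y)
    (fun i j => ∑ k, partialDeriv k (fun z => G z i j) y * gradCoord G ψ y k) (fun i j => G y i j)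
  beta_reduce at hlin
  rw [hqsymm, hgh] at hlin
  rw [hlin]
  congr 1
  linear_combination -(n : ℝ) * hdiv

/-! ### The Laplacian and the Yamabe equation in coordinates -/

/-- The gradient term is the one that turns the exponential form of the conformal transformation law
into the linear Yamabe equation. -/
theorem laplaceCoord_log {G : E → Matrix (Fin n) (Fin n) ℝ} {y : E} {φ : E → ℝ}
    (hφ : ContDiffAt ℝ 2 φ y) (hpos : ∀ z, 0 < φ z) (c : ℝ) :
    laplaceCoord G (fun z => c * Real.log (φ z)) y
      = c * (laplaceCoord G φ y / φ y
        - (∑ k, partialDeriv k φ y * gradCoord G φ y k) / φ y ^ 2) := by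
  have h1 : ∀ {z}, DifferentiableAt ℝ φ z → ∀ i, partialDeriv i (fun z => c * Real.log (φ z)) z
      = c * (φ z)⁻¹ * partialDeriv i φ z := fun {z} hz i =>
    partialDeriv_comp (q := fun s => c * Real.log s)
      ((Real.hasDerivAt_log (hpos z).ne').const_mul c) hz
  have hd := hφ.differentiableAt (by norm_num)
  have h2 : ∀ i j, partialDeriv i (partialDeriv j (fun z => c * Real.log (φ z))) y
      = c * ((φ y)⁻¹ * partialDeriv i (partialDeriv j φ) y
        - ((φ y) ^ 2)⁻¹ * (partialDeriv i φ y * partialDeriv j φ y)) := by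
    intro i j
    have hinv : HasDerivAt (fun s : ℝ => c * s⁻¹) (c * -(φ y ^ 2)⁻¹) (φ y) :=
      (hasDerivAt_inv (hpos y).ne').const_mul c
    rw [partialDeriv_congr ((eventually_differentiableAt hφ).mono fun z hz => h1 hz j),
      partialDeriv_mul (F := fun z => c * (φ z)⁻¹) (hinv.differentiableAt.comp y hd)
        (differentiableAt_partialDeriv hφ),
      partialDeriv_comp hinv hd]
    ring
  have e : ∀ i j, (G y)⁻¹ i j * (partialDeriv i (partialDeriv j (fun z => c * Real.log (φ z))) y
        - ∑ k, christoffel G k i j y * partialDeriv k (fun z => c * Real.log (φ z)) y)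
      = c * (φ y)⁻¹ * ((G y)⁻¹ i j * (partialDeriv i (partialDeriv j φ) y
        - ∑ k, christoffel G k i j y * partialDeriv k φ y))
        - c * (φ y ^ 2)⁻¹ * (partialDeriv i φ y * ((G y)⁻¹ i j * partialDeriv j φ y)) := by
    intro i j
    have : ∑ k, christoffel G k i j y * partialDeriv k (fun z => c * Real.log (φ z)) y
        = c * (φ y)⁻¹ * ∑ k, christoffel G k i j y * partialDeriv k φ y := by
      rw [mul_sum]
      exact sum_congr rfl fun k _ => by rw [h1 hd]; ring
    rw [h2, this]
    ring
  simp only [laplaceCoord, gradCoord, e, sum_sub_distrib, ← mul_sum]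
  ring

/-- The conformal transformation law of the scalar curvature in the form of the Yamabe equation. -/
theorem IsMetricAt.scalarCoord_rpow_smul {G : E → Matrix (Fin n) (Fin n) ℝ} {y : E} (hn : 3 ≤ n)
    (hG : IsMetricAt G y) {φ : E → ℝ} (hφ : ContDiffAt ℝ 2 φ y) (hpos : ∀ z, 0 < φ z) :
    scalarCoord (fun z => (φ z ^ (4 / ((n : ℝ) - 2))) • G z) y
      = φ y ^ (-(4 / ((n : ℝ) - 2))) * (scalarCoord G y
        - 4 * (n - 1) / (n - 2) * (laplaceCoord G φ y / φ y)) := by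
  have hn2 : (0 : ℝ) < n - 2 := by
    have : (3 : ℝ) ≤ n := by exact_mod_cast hn
    linarith
  have hexp : ∀ z, φ z ^ (4 / ((n : ℝ) - 2))
      = Real.exp (2 * (2 / ((n : ℝ) - 2) * Real.log (φ z))) := fun z => by
    rw [Real.rpow_def_of_pos (hpos z)]
    ring_nf
  have hψ : ContDiffAt ℝ 2 (fun z => 2 / ((n : ℝ) - 2) * Real.log (φ z)) y :=
    contDiffAt_const.mul (hφ.log (hpos y).ne')
  have hgrad : ∀ k, partialDeriv k (fun z => 2 / ((n : ℝ) - 2) * Real.log (φ z)) y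
      = 2 / ((n : ℝ) - 2) * (φ y)⁻¹ * partialDeriv k φ y := fun k =>
    partialDeriv_comp (q := fun s => 2 / ((n : ℝ) - 2) * Real.log s)
      ((Real.hasDerivAt_log (hpos y).ne').const_mul _) (hφ.differentiableAt (by norm_num))
  have hN : ∑ k, partialDeriv k (fun z => 2 / ((n : ℝ) - 2) * Real.log (φ z)) y
        * gradCoord G (fun z => 2 / ((n : ℝ) - 2) * Real.log (φ z)) y k
      = (2 / ((n : ℝ) - 2) * (φ y)⁻¹) ^ 2 * ∑ k, partialDeriv k φ y * gradCoord G φ y k := by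
    simp only [gradCoord, hgrad, mul_sum]
    exact sum_congr rfl fun k _ => sum_congr rfl fun l _ => by ring
  rw [Real.rpow_neg (hpos y).le]
  simp only [hexp]
  rw [hG.scalarCoord_exp_smul hψ, laplaceCoord_log hφ hpos, hN]
  congr 1
  have := (hpos y).ne'
  field_simp
  ring

theorem partialDeriv_partialDeriv {F : E → ℝ} {y : E} (hF : ContDiffAt ℝ 2 F y) (i j : Fin n) :
    partialDeriv i (partialDeriv j F) y
      = fderiv ℝ (fderiv ℝ F) y (EuclideanSpace.single i 1) (EuclideanSpace.single j 1) := by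
  have h : DifferentiableAt ℝ (fderiv ℝ F) y :=
    (hF.fderiv_right (m := 1) (by norm_num)).differentiableAt (by norm_num)
  have := (h.hasFDerivAt.clm_apply
    (hasFDerivAt_const (EuclideanSpace.single j (1 : ℝ) : E) y)).fderiv
  have h2 : fderiv ℝ (partialDeriv j F) y (EuclideanSpace.single i 1) = _ :=
    congrArg (fun L : E →L[ℝ] ℝ => L (EuclideanSpace.single i 1)) this
  rw [partialDeriv, h2]
  simp

/-- The second order necessary condition for a local minimum. -/
theorem fderiv_fderiv_nonneg_of_isLocalMin {V : Type*} [NormedAddCommGroup V] [NormedSpace ℝ V]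
    {F : V → ℝ} {y : V} (hF : ContDiffAt ℝ 2 F y) (hmin : IsLocalMin F y) (v : V) :
    0 ≤ fderiv ℝ (fderiv ℝ F) y v v := by
  have hline : Tendsto (fun s : ℝ => y + s • v) (𝓝 0) (𝓝 y) := by
    have : Continuous fun s : ℝ => y + s • v := by fun_prop
    simpa using this.tendsto 0
  have hl : ∀ s : ℝ, HasDerivAt (fun s : ℝ => y + s • v) v s := fun s => by
    simpa using ((hasDerivAt_id s).smul_const v).const_add y
  have h1 : ∀ᶠ s : ℝ in 𝓝 0, deriv (fun s : ℝ => F (y + s • v)) s = fderiv ℝ F (y + s • v) v := by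
    filter_upwards [hline.eventually ((hF.eventually (by simp)).mono
      fun z hz => hz.differentiableAt (by norm_num))] with s hs
    exact (HasFDerivAt.comp_hasDerivAt (f := fun s : ℝ => y + s • v) s hs.hasFDerivAt (hl s)).deriv
  have h2 : deriv (deriv fun s : ℝ => F (y + s • v)) 0 = fderiv ℝ (fderiv ℝ F) y v v := by
    rw [EventuallyEq.deriv_eq h1]
    have hd : DifferentiableAt ℝ (fderiv ℝ F) (y + (0 : ℝ) • v) := by
      simpa using (hF.fderiv_right (m := 1) (by norm_num)).differentiableAt (by norm_num)
    have hc : HasDerivAt (fun s : ℝ => fderiv ℝ F (y + s • v))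
        (fderiv ℝ (fderiv ℝ F) (y + (0 : ℝ) • v) v) 0 :=
      HasFDerivAt.comp_hasDerivAt (f := fun s : ℝ => y + s • v) (0 : ℝ) hd.hasFDerivAt (hl 0)
    rw [(hc.clm_apply (hasDerivAt_const (0 : ℝ) v)).deriv]
    simp
  have hmin' : IsLocalMin (fun s : ℝ => F (y + s • v)) 0 := by
    have : ∀ᶠ z in 𝓝 y, F y ≤ F z := hmin
    filter_upwards [hline.eventually this] with s hs
    simpa using hs
  rw [← h2]
  by_contra! hneg
  have hc : ContinuousAt (fun s : ℝ => F (y + s • v)) 0 := by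
    have : ContinuousAt F (y + (0 : ℝ) • v) := by simpa using hF.continuousAt
    exact this.comp (f := fun s : ℝ => y + s • v) (by fun_prop)
  -- a negative second derivative would make the point a maximum along the line too, so `F` would be
  -- constant there
  have hmax := isLocalMax_of_deriv_deriv_neg hneg hmin'.deriv_eq_zero hc
  have hconst : (fun s : ℝ => F (y + s • v)) =ᶠ[𝓝 0] fun _ => F (y + (0 : ℝ) • v) := by
    filter_upwards [hmin', hmax] with s hs1 hs2 using le_antisymm hs2 hs1
  have : deriv (deriv fun s : ℝ => F (y + s • v)) 0 = 0 := by
    rw [hconst.deriv.deriv_eq]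
    simp
  linarith

/-- At a local minimum the Laplacian is nonnegative. -/
theorem IsMetricAt.laplaceCoord_nonneg {G : E → Matrix (Fin n) (Fin n) ℝ} {y : E}
    (hG : IsMetricAt G y) {F : E → ℝ} (hF : ContDiffAt ℝ 2 F y) (hmin : IsLocalMin F y) :
    0 ≤ laplaceCoord G F y := by
  have h0 : ∀ k, partialDeriv k F y = 0 := fun k => by
    rw [partialDeriv, hmin.fderiv_eq_zero]; rfl
  simp only [laplaceCoord, h0, mul_zero, sum_const_zero, sub_zero, partialDeriv_partialDeriv hF]
  -- factor `g⁻¹ = Bᵀ B`, so that the contraction is a sum of second derivatives along vectors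
  obtain ⟨B, hB⟩ := CStarAlgebra.nonneg_iff_eq_star_mul_self.mp
    hG.posDef.self_of_nhds.inv.posSemidef.nonneg
  rw [Matrix.star_eq_conjTranspose] at hB
  set D := fderiv ℝ (fderiv ℝ F) y
  have : ∑ i, ∑ j, (G y)⁻¹ i j * D (EuclideanSpace.single i 1) (EuclideanSpace.single j 1)
      = ∑ k, D (∑ i, B k i • EuclideanSpace.single i (1 : ℝ))
          (∑ i, B k i • EuclideanSpace.single i (1 : ℝ)) := by
    simp only [hB, Matrix.mul_apply, Matrix.conjTranspose_apply, star_trivial, map_sum, map_smul,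
      _root_.sum_apply, smul_apply, smul_eq_mul, sum_mul, mul_sum]
    rw [sum_congr rfl fun i _ => sum_comm, sum_comm]
    refine sum_congr rfl fun k _ => ?_
    rw [sum_comm]
    exact sum_congr rfl fun i _ => sum_congr rfl fun j _ => by ring
  rw [this]
  exact sum_nonneg fun k _ => fderiv_fderiv_nonneg_of_isLocalMin hF hmin _

theorem laplaceCoord_const_mul_sub {G : E → Matrix (Fin n) (Fin n) ℝ} {y : E} {F H : E → ℝ}
    (hF : ContDiffAt ℝ 2 F y) (hH : ContDiffAt ℝ 2 H y) (r : ℝ) :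
    laplaceCoord G (fun z => r * F z - H z) y = r * laplaceCoord G F y - laplaceCoord G H y := by
  have h1 : ∀ {z}, DifferentiableAt ℝ F z → DifferentiableAt ℝ H z → ∀ i,
      partialDeriv i (fun z => r * F z - H z) z = r * partialDeriv i F z - partialDeriv i H z :=
    fun h1 h2 i => by rw [partialDeriv_sub (h1.const_mul r) h2, partialDeriv_const_mul r h1]
  have h2 : ∀ i j, partialDeriv i (partialDeriv j (fun z => r * F z - H z)) y
      = r * partialDeriv i (partialDeriv j F) y - partialDeriv i (partialDeriv j H) y := by
    intro i j
    rw [partialDeriv_congr (((eventually_differentiableAt hF).and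
        (eventually_differentiableAt hH)).mono fun z hz => h1 hz.1 hz.2 j),
      partialDeriv_sub ((differentiableAt_partialDeriv hF).const_mul r)
        (differentiableAt_partialDeriv hH),
      partialDeriv_const_mul r (differentiableAt_partialDeriv hF)]
  simp only [laplaceCoord, h2, h1 (hF.differentiableAt (by norm_num))
    (hH.differentiableAt (by norm_num)), mul_sub, mul_left_comm _ r, sum_sub_distrib, ← mul_sum]
  ring

end Coordinates

/-! ### The maximum principle for difference quotients in time -/

section MaximumPrinciple

open Filter Topology

/-- A maximum principle: an upper bound for `∂ₜΦ` at the spatial maxima of `Φ` propagates an upper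
bound for `Φ`. -/
theorem le_of_deriv_le_at_max {Y : Type*} [TopologicalSpace Y] [CompactSpace Y] {s : ℝ}
    {Φ Φ' : ℝ → Y → ℝ}
    (hc : ContinuousOn (fun z : ℝ × Y => Φ z.1 z.2) (Icc 0 s ×ˢ univ))
    (hd : ∀ t ∈ Icc 0 s, ∀ y, HasDerivWithinAt (fun t => Φ t y) (Φ' t y) (Icc 0 s) t)
    {β η K : ℝ} (hβ : 0 ≤ β) (hη : 0 ≤ η)
    (hmax : ∀ t ∈ Icc 0 s, ∀ y, (∀ y', Φ t y' ≤ Φ t y) → Φ' t y ≤ -β * Φ t y + η)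
    (h0 : ∀ y, Φ 0 y ≤ K) :
    ∀ t ∈ Icc 0 s, ∀ y, Φ t y ≤ K * Real.exp (-β * t) + η * t := by
  -- the barrier is made strict by `ε`
  have key : ∀ ε > 0, ∀ t ∈ Icc 0 s, ∀ y,
      Φ t y < (K + ε) * Real.exp (-β * t) + (η + ε) * t := by
    intro ε hε
    set v : ℝ → ℝ := fun t => (K + ε) * Real.exp (-β * t) + (η + ε) * t with hv
    have hvd : ∀ t, HasDerivAt v (-β * ((K + ε) * Real.exp (-β * t)) + (η + ε)) t := by
      intro t
      have h1 : HasDerivAt (fun t => Real.exp (-β * t)) (Real.exp (-β * t) * (-β * 1)) t :=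
        ((hasDerivAt_id t).const_mul (-β)).exp
      exact ((h1.const_mul (K + ε)).fun_add ((hasDerivAt_id t).const_mul (η + ε))).congr_deriv
        (by ring)
    have hvc : Continuous v := by fun_prop
    by_contra! hcon
    obtain ⟨t₁, ht₁, y₁, hy₁⟩ := hcon
    have hcompact : IsCompact {z ∈ Icc 0 s ×ˢ (univ : Set Y) | v z.1 ≤ Φ z.1 z.2} := by
      have : {z ∈ Icc 0 s ×ˢ (univ : Set Y) | v z.1 ≤ Φ z.1 z.2}
          = (Icc 0 s ×ˢ (univ : Set Y)) ∩ (fun z => Φ z.1 z.2 - v z.1) ⁻¹' Ici 0 := by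
        ext z; simp [sub_nonneg]
      rw [this]
      refine (isCompact_Icc.prod isCompact_univ).of_isClosed_subset ?_ inter_subset_left
      exact (hc.sub (by fun_prop)).preimage_isClosed_of_isClosed
        (isClosed_Icc.prod isClosed_univ) isClosed_Ici
    -- `t₀` is the first time at which `Φ` reaches the barrier `v`
    obtain ⟨t₀, ⟨⟨z, hz, hzt⟩, hleast⟩⟩ := (hcompact.image continuous_fst).exists_isLeast
      ⟨t₁, ⟨(t₁, y₁), ⟨⟨ht₁, mem_univ _⟩, hy₁⟩, rfl⟩⟩
    obtain ⟨t, y⟩ := z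
    obtain rfl : t = t₀ := hzt
    have ht : t ∈ Icc 0 s := hz.1.1
    have hbefore : ∀ τ ∈ Ico 0 t, ∀ y', Φ τ y' < v τ := by
      intro τ hτ y'
      by_contra! h
      have := hleast ⟨(τ, y'), ⟨⟨⟨hτ.1, hτ.2.le.trans ht.2⟩, mem_univ _⟩, h⟩, rfl⟩
      exact absurd hτ.2 (not_lt.2 this)
    have htpos : 0 < t := by
      rcases ht.1.eq_or_lt with h | h
      · have h2 : v t ≤ Φ t y := hz.2
        rw [← h] at h2
        have := h0 y
        simp [hv] at h2
        linarith
      · exact h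
    have hcl : ∀ y', Φ t y' ≤ v t := by
      intro y'
      have h1 : Tendsto (fun τ => v τ - Φ τ y') (𝓝[Ioo 0 t] t) (𝓝 (v t - Φ t y')) := by
        refine hvc.continuousWithinAt.sub (((hd t ht y').continuousWithinAt).mono ?_)
        exact fun τ hτ => ⟨hτ.1.le, hτ.2.le.trans ht.2⟩
      have : (𝓝[Ioo 0 t] t).NeBot := right_nhdsWithin_Ioo_neBot htpos
      have := ge_of_tendsto h1 (b := 0) (by
        filter_upwards [self_mem_nhdsWithin] with τ hτ
        exact sub_nonneg.2 (hbefore τ ⟨hτ.1.le, hτ.2⟩ y').le)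
      linarith
    have heq : Φ t y = v t := le_antisymm (hcl y) hz.2
    have hΦ' := hmax t ht y fun y' => by rw [heq]; exact hcl y'
    have hdiff : HasDerivWithinAt (fun τ => Φ τ y - v τ)
        (Φ' t y - (-β * ((K + ε) * Real.exp (-β * t)) + (η + ε))) (Ioo 0 t) t :=
      ((hd t ht y).mono fun τ hτ => ⟨hτ.1.le, hτ.2.le.trans ht.2⟩).sub (hvd t).hasDerivWithinAt
    rw [hasDerivWithinAt_iff_tendsto_slope' (by simp)] at hdiff
    have : (𝓝[Ioo 0 t] t).NeBot := right_nhdsWithin_Ioo_neBot htpos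
    have hnn := ge_of_tendsto hdiff (b := 0) (by
      filter_upwards [self_mem_nhdsWithin] with τ hτ
      rw [slope_def_field, heq, sub_self, sub_zero]
      exact div_nonneg_of_nonpos (sub_nonpos.2 (hbefore τ ⟨hτ.1.le, hτ.2⟩ y).le)
        (sub_nonpos.2 hτ.2.le))
    rw [heq] at hΦ'
    have : 0 ≤ β * ((η + ε) * t) := by positivity
    simp only [hv] at hΦ'
    linarith
  intro t ht y
  refine le_of_forall_pos_lt_add fun δ hδ => ?_
  have hpos : 0 < Real.exp (-β * t) + t := add_pos_of_pos_of_nonneg (Real.exp_pos _) ht.1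
  have := key (δ / (Real.exp (-β * t) + t)) (div_pos hδ hpos) t ht y
  have e : δ / (Real.exp (-β * t) + t) * (Real.exp (-β * t) + t) = δ := div_mul_cancel₀ _ hpos.ne'
  linarith

/-- Continuity in time, uniformly over a compact space. -/
theorem exists_uniform_modulus {X : Type*} [TopologicalSpace X] [CompactSpace X] {s : ℝ}
    {k : ℝ → X → ℝ} (hk : ContinuousOn (fun z : ℝ × X => k z.1 z.2) (Icc 0 s ×ˢ univ))
    {ε : ℝ} (hε : 0 < ε) :
    ∃ δ > 0, ∀ t ∈ Icc 0 s, ∀ t' ∈ Icc 0 s, |t - t'| < δ → ∀ x, |k t x - k t' x| ≤ ε := by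
  have hc : Continuous fun z : Icc 0 s × X => k z.1 z.2 :=
    hk.comp_continuous (f := fun z : Icc 0 s × X => ((z.1 : ℝ), z.2)) (by fun_prop)
      fun z => ⟨z.1.2, mem_univ _⟩
  have hu := CompactSpace.uniformContinuous_of_continuous (ContinuousMap.mk _ hc).curry.continuous
  obtain ⟨δ, hδ, h⟩ := Metric.uniformContinuous_iff.1 hu ε hε
  refine ⟨δ, hδ, fun t ht t' ht' htt x => ?_⟩
  have := (ContinuousMap.dist_lt_iff hε).1 (h (a := ⟨t, ht⟩) (b := ⟨t', ht'⟩) htt) x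
  exact this.le

/-- Difference quotients in time converge uniformly. -/
theorem exists_uniform_difference {X : Type*} [TopologicalSpace X] [CompactSpace X] {s : ℝ}
    {w k : ℝ → X → ℝ} (hk : ContinuousOn (fun z : ℝ × X => k z.1 z.2) (Icc 0 s ×ˢ univ))
    (hd : ∀ t ∈ Icc 0 s, ∀ x, HasDerivWithinAt (fun t => w t x) (k t x) (Icc 0 s) t)
    {ε : ℝ} (hε : 0 < ε) :
    ∃ δ > 0, ∀ h, 0 < h → h < δ → ∀ t, t ∈ Icc 0 s → t + h ∈ Icc 0 s → ∀ x,
      |w (t + h) x - w t x - h * k t x| ≤ ε * h := by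
  obtain ⟨δ, hδ, hmod⟩ := exists_uniform_modulus hk hε
  refine ⟨δ, hδ, fun h h0 hhδ t ht hth x => ?_⟩
  have hsub : Icc t (t + h) ⊆ Icc 0 s := Icc_subset_Icc ht.1 hth.2
  have hg : ∀ τ ∈ Icc t (t + h), HasDerivWithinAt (fun τ => w τ x - τ * k t x)
      (k τ x - k t x) (Icc t (t + h)) τ := fun τ hτ =>
    (((hd τ (hsub hτ) x).mono hsub).fun_sub
      ((hasDerivWithinAt_id τ _).mul_const (k t x))).congr_deriv (by ring)
  have := (convex_Icc t (t + h)).norm_image_sub_le_of_norm_hasDerivWithin_le hg (C := ε)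
    (fun τ hτ => hmod τ (hsub hτ) t ht (by
      rw [abs_of_nonneg (by linarith [hτ.1])]; linarith [hτ.2]) x)
    (left_mem_Icc.2 (by linarith)) (right_mem_Icc.2 (by linarith))
  rw [Real.norm_eq_abs, Real.norm_eq_abs, add_sub_cancel_left, abs_of_pos h0] at this
  convert this using 2
  ring

theorem hasDerivWithinAt_shift {g g' : ℝ → ℝ} {s h t₁ : ℝ} (hh : 0 ≤ h) (hs : t₁ + h ≤ s)
    (hg : ∀ t ∈ Icc 0 s, HasDerivWithinAt g (g' t) (Icc 0 s) t) :
    ∀ t ∈ Icc 0 t₁, HasDerivWithinAt (fun t => g (t + h) - g t) (g' (t + h) - g' t)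
      (Icc 0 t₁) t := by
  intro t ht
  have h1 : HasDerivWithinAt (fun t => g (t + h)) (g' (t + h)) (Icc 0 t₁) t := by
    have hsh : HasDerivWithinAt (fun t : ℝ => t + h) 1 (Icc 0 t₁) t :=
      (hasDerivWithinAt_id t _).add_const h
    have hm : MapsTo (fun t : ℝ => t + h) (Icc 0 t₁) (Icc 0 s) := fun τ hτ =>
      ⟨by linarith [hτ.1], by linarith [hτ.2]⟩
    exact ((hg (t + h) (hm ht)).comp t hsh hm).congr_deriv (mul_one _)
  exact h1.sub ((hg t ⟨ht.1, by linarith [ht.2]⟩).mono (Icc_subset_Icc_right (by linarith)))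

theorem continuousOn_shift {X : Type*} [TopologicalSpace X] {g : ℝ → X → ℝ} {s h t₁ : ℝ}
    (hh : 0 ≤ h) (hs : t₁ + h ≤ s)
    (hg : ContinuousOn (fun z : ℝ × X => g z.1 z.2) (Icc 0 s ×ˢ univ)) :
    ContinuousOn (fun z : ℝ × X => g (z.1 + h) z.2 - g z.1 z.2) (Icc 0 t₁ ×ˢ univ) := by
  refine ContinuousOn.sub ?_ (hg.mono (prod_mono_left (Icc_subset_Icc_right (by linarith))))
  exact hg.comp (f := fun z : ℝ × X => (z.1 + h, z.2)) (by fun_prop)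
    fun z hz => ⟨⟨by linarith [hz.1.1], by linarith [hz.1.2]⟩, mem_univ _⟩

theorem exists_antideriv {A : ℝ → ℝ} {s : ℝ} (hs : 0 ≤ s) (hA : ContinuousOn A (Icc 0 s)) :
    ∃ a : ℝ → ℝ, ∀ t ∈ Icc 0 s, HasDerivWithinAt a (A t) (Icc 0 s) t := by
  have hc : Continuous (IccExtend hs ((Icc 0 s).domRestrict A)) :=
    (continuousOn_iff_continuous_domRestrict.1 hA).Icc_extend'
  refine ⟨fun t => ∫ τ in (0 : ℝ)..t, IccExtend hs ((Icc 0 s).domRestrict A) τ, fun t ht => ?_⟩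
  have := (hc.integral_hasStrictDerivAt 0 t).hasDerivAt.hasDerivWithinAt (s := Icc 0 s)
  rwa [IccExtend_of_mem hs _ ht] at this

/-- The analytic content of the flow on `[0,s]`: a function `w` with `∂ₜw = F(σ) - A`, where `F` is
nondecreasing, `A` lies between the extrema of `F(σ)`, and `σ + w` does not increase between two
times at the points where `w` has increased the most. The constants `β`, `Λ` bound the slopes of `F`
on an interval containing the values of `σ`. -/
structure MonotoneFlow {X : Type*} [TopologicalSpace X] (s l r β Λ : ℝ) (F A : ℝ → ℝ)
    (w σ : ℝ → X → ℝ) : Prop where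
  mem : ∀ t ∈ Icc 0 s, ∀ x, σ t x ∈ Icc l r
  continuousOn_w : ContinuousOn (fun z : ℝ × X => w z.1 z.2) (Icc 0 s ×ˢ univ)
  continuousOn_Fσ : ContinuousOn (fun z : ℝ × X => F (σ z.1 z.2)) (Icc 0 s ×ˢ univ)
  continuousOn_A : ContinuousOn A (Icc 0 s)
  hasDeriv : ∀ t ∈ Icc 0 s, ∀ x,
    HasDerivWithinAt (fun t => w t x) (F (σ t x) - A t) (Icc 0 s) t
  exists_ge : ∀ t ∈ Icc 0 s, ∃ x, A t ≤ F (σ t x)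
  exists_le : ∀ t ∈ Icc 0 s, ∃ x, F (σ t x) ≤ A t
  comparison : ∀ t ∈ Icc 0 s, ∀ t' ∈ Icc 0 s, ∀ x,
    (∀ y, w t' y - w t y ≤ w t' x - w t x) → σ t' x + w t' x ≤ σ t x + w t x
  β_nonneg : 0 ≤ β
  le_slope : ∀ a ∈ Icc l r, ∀ b ∈ Icc l r, a ≤ b → β * (b - a) ≤ F b - F a
  slope_le : ∀ a ∈ Icc l r, ∀ b ∈ Icc l r, a ≤ b → F b - F a ≤ Λ * (b - a)
  Λ_nonneg : 0 ≤ Λ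

namespace MonotoneFlow

variable {X : Type*} [TopologicalSpace X] [CompactSpace X] {s l r β Λ : ℝ} {F A : ℝ → ℝ}
  {w σ : ℝ → X → ℝ}

/-- The hypotheses are symmetric under reversing all signs: the comparison at `(t, t')` becomes the
one at `(t', t)`. -/
theorem neg {X : Type*} [TopologicalSpace X] {s l r β Λ : ℝ} {F A : ℝ → ℝ}
    {w σ : ℝ → X → ℝ} (H : MonotoneFlow s l r β Λ F A w σ) :
    MonotoneFlow s (-r) (-l) β Λ (fun a => -F (-a)) (fun t => -A t) (fun t x => -w t x)
      (fun t x => -σ t x) where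
  mem t ht x := ⟨neg_le_neg (H.mem t ht x).2, neg_le_neg (H.mem t ht x).1⟩
  continuousOn_w := H.continuousOn_w.neg
  continuousOn_Fσ := by simpa only [neg_neg] using H.continuousOn_Fσ.fun_neg
  continuousOn_A := H.continuousOn_A.neg
  hasDeriv t ht x := (H.hasDeriv t ht x).fun_neg.congr_deriv (by rw [neg_neg]; ring)
  exists_ge t ht := by simpa only [neg_neg, neg_le_neg_iff] using H.exists_le t ht
  exists_le t ht := by simpa only [neg_neg, neg_le_neg_iff] using H.exists_ge t ht
  comparison t ht t' ht' x hx := by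
    have := H.comparison t' ht' t ht x fun y => by linarith [hx y]
    linarith
  β_nonneg := H.β_nonneg
  le_slope a ha b hb hab := by
    have := H.le_slope (-b) ⟨by linarith [hb.2], by linarith [hb.1]⟩ (-a)
      ⟨by linarith [ha.2], by linarith [ha.1]⟩ (by linarith)
    linarith
  slope_le a ha b hb hab := by
    have := H.slope_le (-b) ⟨by linarith [hb.2], by linarith [hb.1]⟩ (-a)
      ⟨by linarith [ha.2], by linarith [ha.1]⟩ (by linarith)
    linarith
  Λ_nonneg := H.Λ_nonneg

/-- At a point of largest increase of `w` between two times, an almost nonnegative increase of `w`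
forces `F(σ)` to decrease at least proportionally. -/
theorem sub_le {X : Type*} [TopologicalSpace X] {s l r β Λ : ℝ} {F A : ℝ → ℝ}
    {w σ : ℝ → X → ℝ} (H : MonotoneFlow s l r β Λ F A w σ) {t t' : ℝ} (ht : t ∈ Icc 0 s)
    (ht' : t' ∈ Icc 0 s) {x : X} (hx : ∀ y, w t' y - w t y ≤ w t' x - w t x) {e : ℝ}
    (he : 0 ≤ e) (hd : -e ≤ w t' x - w t x) :
    F (σ t' x) - F (σ t x) ≤ -β * (w t' x - w t x) + Λ * e := by
  have hcomp := H.comparison t ht t' ht' x hx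
  have hβ := H.β_nonneg
  have hΛe := mul_nonneg H.Λ_nonneg he
  rcases le_total (σ t' x) (σ t x) with h | h
  · have h1 := H.le_slope _ (H.mem t' ht' x) _ (H.mem t ht x) h
    have h2 : β * (w t' x - w t x) ≤ β * (σ t x - σ t' x) :=
      mul_le_mul_of_nonneg_left (by linarith) hβ
    linarith
  · have h1 := H.slope_le _ (H.mem t ht x) _ (H.mem t' ht' x) h
    have h2 : Λ * (σ t' x - σ t x) ≤ Λ * e := mul_le_mul_of_nonneg_left (by linarith) H.Λ_nonneg
    have h3 : 0 ≤ β * (-(w t' x - w t x)) := mul_nonneg hβ (by linarith)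
    linarith

/-- Over a short time `h` the increment of `w` is `h ∂ₜw` up to `ε h`, uniformly in space and time;
since `A` lies between the extrema of `F(σ)`, some increment is at least `-ε h` and some increment
is at most `ε h`. -/
theorem exists_uniform_increment (H : MonotoneFlow s l r β Λ F A w σ) {ε : ℝ} (hε : 0 < ε) :
    ∃ δ > 0, ∀ h, 0 < h → h < δ → ∀ t, t ∈ Icc 0 s → t + h ∈ Icc 0 s →
      (∀ x, |w (t + h) x - w t x - h * (F (σ t x) - A t)| ≤ ε * h) ∧
      (∃ x, -(ε * h) ≤ w (t + h) x - w t x) ∧ ∃ x, w (t + h) x - w t x ≤ ε * h := by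
  have hk : ContinuousOn (fun z : ℝ × X => F (σ z.1 z.2) - A z.1) (Icc 0 s ×ˢ univ) :=
    H.continuousOn_Fσ.sub (H.continuousOn_A.comp continuousOn_fst fun z hz => hz.1)
  obtain ⟨δ, hδ, hdiff⟩ := exists_uniform_difference hk H.hasDeriv hε
  refine ⟨δ, hδ, fun h h0 hhδ t ht hth => ⟨hdiff h h0 hhδ t ht hth, ?_, ?_⟩⟩
  · obtain ⟨x, hx⟩ := H.exists_ge t ht
    refine ⟨x, ?_⟩
    have := (abs_le.1 (hdiff h h0 hhδ t ht hth x)).1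
    have h2 : 0 ≤ h * (F (σ t x) - A t) := mul_nonneg h0.le (by linarith)
    linarith
  · obtain ⟨x, hx⟩ := H.exists_le t ht
    refine ⟨x, ?_⟩
    have := (abs_le.1 (hdiff h h0 hhδ t ht hth x)).2
    have h2 : 0 ≤ h * (A t - F (σ t x)) := mul_nonneg h0.le (by linarith)
    linarith

/-- The maximum of `F(σ)` does not increase. As `F(σ)` need not be differentiable in time, the
maximum principle is applied to the difference quotients of a function with time derivative `F(σ)`.
-/
theorem le_of_initial_le (H : MonotoneFlow s l r β Λ F A w σ) {K : ℝ}
    (hK : ∀ x, F (σ 0 x) ≤ K) {t : ℝ} (ht : t ∈ Ico 0 s) (x : X) : F (σ t x) ≤ K := by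
  have hs : 0 ≤ s := ht.1.trans ht.2.le
  obtain ⟨a, ha⟩ := exists_antideriv hs H.continuousOn_A
  have hW : ∀ t ∈ Icc 0 s, ∀ x,
      HasDerivWithinAt (fun t => w t x + a t) (F (σ t x)) (Icc 0 s) t := fun t ht x =>
    ((H.hasDeriv t ht x).fun_add (ha t ht)).congr_deriv (by ring)
  have key : ∀ ε > 0, F (σ t x) ≤ K + ε * (2 + (β + Λ) * t) := by
    intro ε hε
    obtain ⟨δ₁, hδ₁, h₁⟩ := H.exists_uniform_increment hε
    obtain ⟨δ₂, hδ₂, h₂⟩ := exists_uniform_difference (w := fun t x => w t x + a t)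
      H.continuousOn_Fσ hW hε
    obtain ⟨h, h0, hh⟩ := exists_between (lt_min (lt_min hδ₁ hδ₂) (sub_pos.2 ht.2))
    have hhδ₁ : h < δ₁ := hh.trans_le ((min_le_left _ _).trans (min_le_left _ _))
    have hhδ₂ : h < δ₂ := hh.trans_le ((min_le_left _ _).trans (min_le_right _ _))
    have hts : t + h ≤ s := by linarith [hh.trans_le (min_le_right _ _)]
    have hin : ∀ τ ∈ Icc 0 t, τ ∈ Icc 0 s := fun τ hτ => ⟨hτ.1, by linarith [hτ.2]⟩
    have hin' : ∀ τ ∈ Icc 0 t, τ + h ∈ Icc 0 s := fun τ hτ =>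
      ⟨by linarith [hτ.1], by linarith [hτ.2]⟩
    have hac : ContinuousOn a (Icc 0 s) := fun τ hτ => (ha τ hτ).continuousWithinAt
    have hβ := H.β_nonneg
    have hΛ := H.Λ_nonneg
    have hmp := le_of_deriv_le_at_max
      (Φ := fun τ x => (w (τ + h) x + a (τ + h)) - (w τ x + a τ))
      (Φ' := fun τ x => F (σ (τ + h) x) - F (σ τ x)) (s := t) (β := 0)
      (η := (β + Λ) * (ε * h)) (K := h * (K + ε))
      (continuousOn_shift (g := fun τ x => w τ x + a τ) h0.le hts
        (H.continuousOn_w.add (hac.comp continuousOn_fst fun z hz => hz.1)))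
      (fun τ hτ x => hasDerivWithinAt_shift h0.le hts (fun τ hτ => hW τ hτ x) τ hτ)
      le_rfl (by positivity) ?_ ?_ t (right_mem_Icc.2 ht.1) x
    · have h3 := (abs_le.1 (h₂ h h0 hhδ₂ t (hin t (right_mem_Icc.2 ht.1))
        (hin' t (right_mem_Icc.2 ht.1)) x)).1
      simp only [neg_zero, zero_mul, Real.exp_zero, mul_one] at hmp
      have h4 : h * F (σ t x) ≤ h * (K + ε * (2 + (β + Λ) * t)) := by linarith
      exact le_of_mul_le_mul_left h4 h0
    · intro τ hτ y hy
      obtain ⟨-, ⟨z, hz⟩, -⟩ := h₁ h h0 hhδ₁ τ (hin τ hτ) (hin' τ hτ)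
      have hymax : ∀ y', w (τ + h) y' - w τ y' ≤ w (τ + h) y - w τ y := fun y' => by
        linarith [hy y']
      have hlow := hz.trans (hymax z)
      have h5 := H.sub_le (hin τ hτ) (hin' τ hτ) hymax (by positivity) hlow
      have h6 : 0 ≤ β * (w (τ + h) y - w τ y + ε * h) := mul_nonneg hβ (by linarith)
      linarith
    · intro y
      have h3 := (abs_le.1 (h₂ h h0 hhδ₂ 0 (left_mem_Icc.2 hs)
        (hin' 0 (left_mem_Icc.2 ht.1)) y)).2
      have h4 : h * F (σ 0 y) ≤ h * K := mul_le_mul_of_nonneg_left (hK y) h0.le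
      simp only [zero_add] at h3 ⊢
      linarith
  refine le_of_forall_pos_lt_add fun δ hδ => ?_
  have hpos : 0 < 2 + (β + Λ) * t := by
    have := mul_nonneg (add_nonneg H.β_nonneg H.Λ_nonneg) ht.1
    linarith
  have := key (δ / 2 / (2 + (β + Λ) * t)) (by positivity)
  rw [div_mul_cancel₀ _ hpos.ne'] at this
  linarith

/-- The minimum of `F(σ)` does not decrease. -/
theorem le_of_le_initial (H : MonotoneFlow s l r β Λ F A w σ) {K : ℝ}
    (hK : ∀ x, K ≤ F (σ 0 x)) {t : ℝ} (ht : t ∈ Ico 0 s) (x : X) : K ≤ F (σ t x) := by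
  have := H.neg.le_of_initial_le (K := -K) (fun x => by simpa using hK x) ht x
  simpa using this

/-- The oscillation of `F(σ)` decays exponentially: the maximum principle on `X × X` is applied to
the differences of the increments of `w` at two points. -/
theorem osc_le (H : MonotoneFlow s l r β Λ F A w σ) {D : ℝ}
    (hD : ∀ x y, F (σ 0 x) - F (σ 0 y) ≤ D) {t : ℝ} (ht : t ∈ Ico 0 s) (x y : X) :
    F (σ t x) - F (σ t y) ≤ D * Real.exp (-β * t) := by
  have hs : 0 ≤ s := ht.1.trans ht.2.le
  have hΛ := H.Λ_nonneg
  have key : ∀ ε > 0, F (σ t x) - F (σ t y) ≤ D * Real.exp (-β * t)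
      + ε * (2 * Real.exp (-β * t) + 2 + 2 * Λ * t) := by
    intro ε hε
    obtain ⟨δ₁, hδ₁, h₁⟩ := H.exists_uniform_increment hε
    obtain ⟨h, h0, hh⟩ := exists_between (lt_min hδ₁ (sub_pos.2 ht.2))
    have hhδ₁ : h < δ₁ := hh.trans_le (min_le_left _ _)
    have hts : t + h ≤ s := by linarith [hh.trans_le (min_le_right _ _)]
    have hin : ∀ τ ∈ Icc 0 t, τ ∈ Icc 0 s := fun τ hτ => ⟨hτ.1, by linarith [hτ.2]⟩
    have hin' : ∀ τ ∈ Icc 0 t, τ + h ∈ Icc 0 s := fun τ hτ =>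
      ⟨by linarith [hτ.1], by linarith [hτ.2]⟩
    have hc := continuousOn_shift h0.le hts H.continuousOn_w
    have hmp := le_of_deriv_le_at_max (Y := X × X)
      (Φ := fun τ z => (w (τ + h) z.1 - w τ z.1) - (w (τ + h) z.2 - w τ z.2))
      (Φ' := fun τ z => ((F (σ (τ + h) z.1) - A (τ + h)) - (F (σ τ z.1) - A τ))
        - ((F (σ (τ + h) z.2) - A (τ + h)) - (F (σ τ z.2) - A τ))) (s := t) (β := β)
      (η := 2 * Λ * (ε * h)) (K := h * (D + 2 * ε))
      ((hc.comp (f := fun z : ℝ × (X × X) => (z.1, z.2.1)) (by fun_prop)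
          fun z hz => ⟨hz.1, mem_univ _⟩).sub
        (hc.comp (f := fun z : ℝ × (X × X) => (z.1, z.2.2)) (by fun_prop)
          fun z hz => ⟨hz.1, mem_univ _⟩))
      (fun τ hτ z =>
        (hasDerivWithinAt_shift h0.le hts (fun τ hτ => H.hasDeriv τ hτ z.1) τ hτ).sub
        (hasDerivWithinAt_shift h0.le hts (fun τ hτ => H.hasDeriv τ hτ z.2) τ hτ))
      H.β_nonneg (by positivity) ?_ ?_ t (right_mem_Icc.2 ht.1) (x, y)
    · have h3 := h₁ h h0 hhδ₁ t (hin t (right_mem_Icc.2 ht.1)) (hin' t (right_mem_Icc.2 ht.1))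
      have hx := (abs_le.1 (h3.1 x)).1
      have hy := (abs_le.1 (h3.1 y)).2
      have h4 : h * (F (σ t x) - F (σ t y)) ≤ h * (D * Real.exp (-β * t)
          + ε * (2 * Real.exp (-β * t) + 2 + 2 * Λ * t)) := by
        simp only at hmp
        linarith
      exact le_of_mul_le_mul_left h4 h0
    · rintro τ hτ ⟨a, b⟩ hab
      obtain ⟨-, ⟨z, hz⟩, ⟨z', hz'⟩⟩ := h₁ h h0 hhδ₁ τ (hin τ hτ) (hin' τ hτ)
      have hamax : ∀ y', w (τ + h) y' - w τ y' ≤ w (τ + h) a - w τ a := fun y' => by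
        have := hab (y', b)
        simp only at this
        linarith
      have hbmin : ∀ y', w τ y' - w (τ + h) y' ≤ w τ b - w (τ + h) b := fun y' => by
        have := hab (a, y')
        simp only at this
        linarith
      have h5 := H.sub_le (hin τ hτ) (hin' τ hτ) hamax (by positivity) (hz.trans (hamax z))
      have h6 := H.sub_le (hin' τ hτ) (hin τ hτ) hbmin (e := ε * h) (by positivity)
        (by linarith [hbmin z'])
      simp only
      linarith
    · rintro ⟨a, b⟩
      have h3 := h₁ h h0 hhδ₁ 0 (left_mem_Icc.2 hs) (hin' 0 (left_mem_Icc.2 ht.1))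
      have ha := (abs_le.1 (h3.1 a)).2
      have hb := (abs_le.1 (h3.1 b)).1
      have h4 : h * (F (σ 0 a) - F (σ 0 b)) ≤ h * D := mul_le_mul_of_nonneg_left (hD a b) h0.le
      simp only at *
      linarith
  refine le_of_forall_pos_lt_add fun δ hδ => ?_
  have hpos : 0 < 2 * Real.exp (-β * t) + 2 + 2 * Λ * t := by
    have := mul_nonneg hΛ ht.1
    have := Real.exp_pos (-β * t)
    linarith
  have := key (δ / 2 / (2 * Real.exp (-β * t) + 2 + 2 * Λ * t)) (by positivity)
  rw [div_mul_cancel₀ _ hpos.ne'] at this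
  linarith

end MonotoneFlow

end MaximumPrinciple

/-! ### Estimates for negative curvature -/

section NegativeCurvature

open Filter Topology

/-- The properties of the logarithmic conformal factor `w` and of the scalar curvature `S` of a
solution that enter into the estimates. -/
structure CurvatureFlow {X : Type*} [TopologicalSpace X] (s : ℝ) (f A : ℝ → ℝ)
    (w S : ℝ → X → ℝ) : Prop where
  continuousOn_w : ContinuousOn (fun z : ℝ × X => w z.1 z.2) (Icc 0 s ×ˢ univ)
  continuousOn_S : ContinuousOn (fun z : ℝ × X => S z.1 z.2) (Icc 0 s ×ˢ univ)
  continuousOn_A : ContinuousOn A (Icc 0 s)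
  hasDeriv : ∀ t ∈ Icc 0 s, ∀ x,
    HasDerivWithinAt (fun t => w t x) (f (S t x) - A t) (Icc 0 s) t
  exists_ge : ∀ t ∈ Icc 0 s, ∃ x, A t ≤ f (S t x)
  exists_le : ∀ t ∈ Icc 0 s, ∃ x, f (S t x) ≤ A t
  comparison : ∀ t ∈ Icc 0 s, ∀ t' ∈ Icc 0 s, ∀ x,
    (∀ y, w t' y - w t y ≤ w t' x - w t x) →
      Real.exp (-(w t' x - w t x)) * S t x ≤ S t' x

namespace CurvatureFlow

variable {X : Type*} [TopologicalSpace X] {s : ℝ} {f A : ℝ → ℝ} {w S : ℝ → X → ℝ}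

/-- As long as the curvature is negative and `f` is decreasing on its range, the logarithm
`σ = log (-S)` turns the flow into a `MonotoneFlow`. -/
theorem monotoneFlow (H : CurvatureFlow s f A w S) (hf : ContDiff ℝ 2 f) {s' : ℝ} (hs' : s' ≤ s)
    {a b β : ℝ} (ha : a < 0) (hb : b < 0) (hβ : 0 ≤ β) (hslope : ∀ x ∈ Icc a b, β ≤ deriv f x * x)
    (hS : ∀ t ∈ Icc 0 s', ∀ x, S t x ∈ Icc a b) :
    ∃ Λ, MonotoneFlow s' (Real.log (-b)) (Real.log (-a)) β Λ (fun σ => f (-Real.exp σ)) A w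
      (fun t x => Real.log (-S t x)) := by
  have hneg : ∀ t ∈ Icc 0 s', ∀ x, S t x < 0 := fun t ht x => (hS t ht x).2.trans_lt hb
  have hFσ : ∀ t ∈ Icc 0 s', ∀ x, f (-Real.exp (Real.log (-S t x))) = f (S t x) := fun t ht x => by
    rw [Real.exp_log (by linarith [hneg t ht x]), neg_neg]
  have hsub : Icc 0 s' ⊆ Icc 0 s := Icc_subset_Icc_right hs'
  have hderiv : ∀ σ, HasDerivAt (fun σ => f (-Real.exp σ))
      (deriv f (-Real.exp σ) * -Real.exp σ) σ := fun σ =>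
    (hf.differentiable (by norm_num) _).hasDerivAt.comp σ (Real.hasDerivAt_exp σ).neg
  have hcd : Continuous fun σ => deriv f (-Real.exp σ) * -Real.exp σ := by
    have := hf.continuous_deriv (by norm_num)
    fun_prop
  have hdf : Differentiable ℝ fun σ => f (-Real.exp σ) := fun σ => (hderiv σ).differentiableAt
  obtain ⟨Λ, hΛ⟩ := (isCompact_Icc (a := Real.log (-b))
    (b := Real.log (-a))).exists_bound_of_continuousOn hcd.continuousOn
  have hrange : ∀ σ ∈ Icc (Real.log (-b)) (Real.log (-a)), -Real.exp σ ∈ Icc a b := by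
    intro σ hσ
    have h1 := Real.exp_le_exp.2 hσ.1
    have h2 := Real.exp_le_exp.2 hσ.2
    rw [Real.exp_log (by linarith)] at h1 h2
    exact ⟨by linarith, by linarith⟩
  refine ⟨max Λ 0, ?_⟩
  constructor
  · exact fun t ht x => ⟨Real.log_le_log (by linarith) (by linarith [(hS t ht x).2]),
      Real.log_le_log (by linarith [hneg t ht x]) (by linarith [(hS t ht x).1])⟩
  · exact H.continuousOn_w.mono (prod_mono_left hsub)
  · refine ((hf.continuous.comp_continuousOn H.continuousOn_S).mono (prod_mono_left hsub)).congr
      fun z hz => hFσ z.1 hz.1 z.2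
  · exact H.continuousOn_A.mono hsub
  · intro t ht x
    simp only [hFσ t ht x]
    exact (H.hasDeriv t (hsub ht) x).mono hsub
  · intro t ht
    simpa only [hFσ t ht] using H.exists_ge t (hsub ht)
  · intro t ht
    simpa only [hFσ t ht] using H.exists_le t (hsub ht)
  · -- multiplying by `-1` and taking logarithms makes the comparison additive
    intro t ht t' ht' x hx
    have h := H.comparison t (hsub ht) t' (hsub ht') x hx
    have h1 : -S t' x ≤ Real.exp (-(w t' x - w t x)) * -S t x := by linarith
    have h2 := Real.log_le_log (by linarith [hneg t' ht' x]) h1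
    rw [Real.log_mul (Real.exp_pos _).ne' (by linarith [hneg t ht x]), Real.log_exp] at h2
    linarith
  · exact hβ
  · intro σ₁ h₁ σ₂ h₂ h
    refine (convex_Icc (Real.log (-b)) (Real.log (-a))).mul_sub_le_image_sub_of_le_deriv
      hdf.continuous.continuousOn hdf.differentiableOn (fun σ hσ => ?_) _ h₁ _ h₂ h
    rw [(hderiv σ).deriv]
    exact hslope _ (hrange σ (interior_subset hσ))
  · intro σ₁ h₁ σ₂ h₂ h
    refine (convex_Icc (Real.log (-b)) (Real.log (-a))).image_sub_le_mul_sub_of_deriv_le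
      hdf.continuous.continuousOn hdf.differentiableOn (fun σ hσ => ?_) _ h₁ _ h₂ h
    rw [(hderiv σ).deriv]
    exact (le_abs_self _).trans ((hΛ σ (interior_subset hσ)).trans (le_max_left _ _))
  · exact le_max_right _ _

/-- The scalar curvature stays in the initial interval. Continuity keeps it for a short time in a
slightly larger interval on which `f` is still decreasing, and there the extrema of `f(S)` are
monotone. -/
theorem mem_Icc [CompactSpace X] (H : CurvatureFlow s f A w S) (hf : ContDiff ℝ 2 f) {a b : ℝ}
    (hab : a ≤ b) (hb : b < 0) (hdecr : ∀ x ∈ Icc a b, deriv f x < 0)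
    (h0 : ∀ x, S 0 x ∈ Icc a b) : ∀ t ∈ Icc 0 s, ∀ x, S t x ∈ Icc a b := by
  have hcd : Continuous (deriv f) := hf.continuous_deriv (by norm_num)
  obtain ⟨δ, hδ, hsub⟩ := (isCompact_Icc (a := a) (b := b)).exists_cthickening_subset_open
    (t := {x | deriv f x < 0} ∩ Iio 0) ((isOpen_Iio.preimage hcd).inter isOpen_Iio)
    fun x hx => ⟨hdecr x hx, hx.2.trans_lt hb⟩
  have hbig : ∀ x ∈ Icc (a - δ) (b + δ), deriv f x < 0 ∧ x < 0 := by
    intro x hx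
    refine hsub (Metric.mem_cthickening_of_dist_le x (max a (min b x)) δ _
      ⟨le_max_left _ _, max_le hab (min_le_left _ _)⟩ ?_)
    rw [Real.dist_eq, abs_le]
    rcases max_cases a (min b x) with h | h <;> rcases min_cases b x with h' | h' <;>
      constructor <;> linarith [hx.1, hx.2]
  have hanti : StrictAntiOn f (Icc (a - δ) (b + δ)) :=
    strictAntiOn_of_deriv_neg (convex_Icc _ _) hf.continuous.continuousOn
      fun x hx => (hbig x (interior_subset hx)).1
  have hslice : ∀ x θ, θ ∈ Icc (0 : ℝ) 1 → ContinuousOn (fun t => S (θ * t) x) (Icc 0 s) := by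
    intro x θ hθ
    refine H.continuousOn_S.comp (f := fun t => (θ * t, x)) (by fun_prop)
      fun t ht => ⟨⟨?_, ?_⟩, mem_univ _⟩
    · exact mul_nonneg hθ.1 ht.1
    · exact (mul_le_of_le_one_left ht.1 hθ.2).trans ht.2
  -- continuous induction on the set of times up to which the curvature stays in `[a, b]`;
  -- the times up to `t` are written as `θ t` with `θ ∈ [0, 1]`
  have hclosed : IsClosed ({t | ∀ θ ∈ Icc (0 : ℝ) 1, ∀ x, S (θ * t) x ∈ Icc a b} ∩ Icc 0 s) := by
    have : {t | ∀ θ ∈ Icc (0 : ℝ) 1, ∀ x, S (θ * t) x ∈ Icc a b} ∩ Icc 0 s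
        = Icc 0 s ∩ ⋂ θ ∈ Icc (0 : ℝ) 1, ⋂ x, Icc 0 s ∩ (fun t => S (θ * t) x) ⁻¹' Icc a b := by
      ext t
      simp only [mem_inter_iff, mem_ofPred_eq, mem_iInter, mem_preimage]
      exact ⟨fun h => ⟨h.2, fun θ hθ x => ⟨h.2, h.1 θ hθ x⟩⟩,
        fun h => ⟨fun θ hθ x => (h.2 θ hθ x).2, h.1⟩⟩
    rw [this]
    exact isClosed_Icc.inter (isClosed_biInter fun θ hθ => isClosed_iInter fun x =>
      (hslice x θ hθ).preimage_isClosed_of_isClosed isClosed_Icc isClosed_Icc)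
  have hall := hclosed.Icc_subset_of_forall_exists_gt (by simpa using fun _ _ _ => h0) ?_
  · intro t ht x
    simpa using hall ht 1 (by simp) x
  rintro t ⟨htP, ht⟩ y hy
  have hbefore : ∀ τ ∈ Icc 0 t, ∀ x, S τ x ∈ Icc a b := by
    intro τ hτ x
    rcases hτ.1.eq_or_lt with h | h
    · rw [← h]; exact h0 x
    · have htpos : 0 < t := h.trans_le hτ.2
      have := htP (τ / t) ⟨by positivity, div_le_one_of_le₀ hτ.2 htpos.le⟩ x
      rwa [div_mul_cancel₀ _ htpos.ne'] at this
  obtain ⟨r, hr, hmod⟩ := exists_uniform_modulus H.continuousOn_S hδ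
  obtain ⟨t', htt', ht'⟩ := exists_between (lt_min (lt_add_of_pos_right t hr) ht.2)
  have ht's : t' ≤ s := (ht'.trans_le (min_le_right _ _)).le
  have hbigS : ∀ τ ∈ Icc 0 t', ∀ x, S τ x ∈ Icc (a - δ) (b + δ) := by
    intro τ hτ x
    rcases le_total τ t with h | h
    · have := hbefore τ ⟨hτ.1, h⟩ x
      exact ⟨by linarith [this.1], by linarith [this.2]⟩
    · have h1 := hbefore t ⟨ht.1, le_rfl⟩ x
      have h2 := abs_le.1 (hmod τ ⟨hτ.1, hτ.2.trans ht's⟩ t ⟨ht.1, ht.2.le⟩ (by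
        rw [abs_of_nonneg (by linarith)]
        linarith [hτ.2, ht'.trans_le (min_le_left _ _)]) x)
      exact ⟨by linarith [h1.1, h2.1], by linarith [h1.2, h2.2]⟩
  obtain ⟨Λ, hM⟩ := H.monotoneFlow hf ht's (by linarith)
    (hbig (b + δ) ⟨by linarith, le_rfl⟩).2 le_rfl
    (fun x hx => (mul_pos_of_neg_of_neg (hbig x hx).1 (hbig x hx).2).le) hbigS
  have hin : ∀ τ ∈ Icc 0 t', ∀ x, f (-Real.exp (Real.log (-S τ x))) = f (S τ x) := fun τ hτ x => by
    rw [Real.exp_log (by linarith [(hbig _ (hbigS τ hτ x)).2]), neg_neg]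
  have h0t' : (0 : ℝ) ∈ Icc 0 t' := ⟨le_rfl, ht.1.trans htt'.le⟩
  have hkeep : ∀ τ ∈ Ico 0 t', ∀ x, S τ x ∈ Icc a b := by
    intro τ hτ x
    have hτ' : τ ∈ Icc 0 t' := ⟨hτ.1, hτ.2.le⟩
    have ha' : a ∈ Icc (a - δ) (b + δ) := ⟨by linarith, by linarith⟩
    have hb' : b ∈ Icc (a - δ) (b + δ) := ⟨by linarith, by linarith⟩
    have h1 := hM.le_of_initial_le (K := f a) (fun x => by
      rw [hin 0 h0t' x]
      exact hanti.antitoneOn ha' (hbigS 0 h0t' x) (h0 x).1) hτ x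
    have h2 := hM.le_of_le_initial (K := f b) (fun x => by
      rw [hin 0 h0t' x]
      exact hanti.antitoneOn (hbigS 0 h0t' x) hb' (h0 x).2) hτ x
    rw [hin τ hτ' x] at h1 h2
    exact ⟨(hanti.le_iff_ge (hbigS τ hτ' x) ha').1 h1, (hanti.le_iff_ge hb' (hbigS τ hτ' x)).1 h2⟩
  obtain ⟨t'', h₁, h₂⟩ := exists_between (lt_min htt' (mem_Ioi.1 hy))
  refine ⟨t'', fun θ hθ x => hkeep _ ⟨mul_nonneg hθ.1 (ht.1.trans h₁.le), ?_⟩ x, h₁,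
    (h₂.trans_le (min_le_right _ _)).le⟩
  exact (mul_le_of_le_one_left (ht.1.trans h₁.le) hθ.2).trans_lt (h₂.trans_le (min_le_left _ _))

/-- Exponential convergence of `f(S)` to its average: the rate `β` is a lower bound for the slope of
`σ ↦ f(-e^σ)`, which is `f'(x) x` at `x = -e^σ`. -/
theorem abs_sub_le [CompactSpace X] (H : CurvatureFlow s f A w S) (hf : ContDiff ℝ 2 f)
    {a b β : ℝ} (hab : a ≤ b) (hb : b < 0) (hdecr : ∀ x ∈ Icc a b, deriv f x < 0) (hβ : 0 ≤ β)
    (hslope : ∀ x ∈ Icc a b, β ≤ deriv f x * x)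
    (h0 : ∀ x, S 0 x ∈ Icc a b) {t : ℝ} (ht : t ∈ Ico 0 s) (x : X) :
    |f (S t x) - A t| ≤ (f a - f b) * Real.exp (-β * t) := by
  have hs : 0 ≤ s := ht.1.trans ht.2.le
  have ht' : t ∈ Icc 0 s := ⟨ht.1, ht.2.le⟩
  have hmem := H.mem_Icc hf hab hb hdecr h0
  obtain ⟨Λ, hM⟩ := H.monotoneFlow hf le_rfl (by linarith) hb hβ hslope hmem
  have hanti : AntitoneOn f (Icc a b) :=
    (strictAntiOn_of_deriv_neg (convex_Icc _ _) hf.continuous.continuousOn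
      fun x hx => hdecr x (interior_subset hx)).antitoneOn
  have hin : ∀ τ ∈ Icc 0 s, ∀ x, f (-Real.exp (Real.log (-S τ x))) = f (S τ x) := fun τ hτ x => by
    rw [Real.exp_log (by linarith [(hmem τ hτ x).2]), neg_neg]
  have hosc : ∀ x y, f (S t x) - f (S t y) ≤ (f a - f b) * Real.exp (-β * t) := by
    intro x y
    have := hM.osc_le (D := f a - f b) (fun x y => by
      rw [hin 0 (left_mem_Icc.2 hs), hin 0 (left_mem_Icc.2 hs)]
      have h1 := hanti (left_mem_Icc.2 hab) (h0 x) (h0 x).1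
      have h2 := hanti (h0 y) (right_mem_Icc.2 hab) (h0 y).2
      linarith) ht x y
    rwa [hin t ht', hin t ht'] at this
  obtain ⟨y, hy⟩ := H.exists_ge t ht'
  obtain ⟨z, hz⟩ := H.exists_le t ht'
  rw [abs_le]
  exact ⟨by linarith [hosc y x], by linarith [hosc x z]⟩

end CurvatureFlow

/-- A function with exponentially decaying derivative is bounded. -/
theorem abs_le_of_abs_deriv_le_exp {g g' : ℝ → ℝ} {s C B : ℝ} (hB : 0 < B) (hC : 0 ≤ C)
    (hg : ∀ t ∈ Icc 0 s, HasDerivWithinAt g (g' t) (Icc 0 s) t) (h0 : g 0 = 0)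
    (hbound : ∀ t ∈ Ico 0 s, |g' t| ≤ C * Real.exp (-B * t)) {t : ℝ} (ht : t ∈ Icc 0 s) :
    |g t| ≤ C / B := by
  have hv : ∀ t, HasDerivAt (fun t => C / B * (1 - Real.exp (-B * t))) (C * Real.exp (-B * t))
      t := by
    intro t
    have h1 : HasDerivAt (fun t => Real.exp (-B * t)) (Real.exp (-B * t) * (-B * 1)) t :=
      ((hasDerivAt_id t).const_mul (-B)).exp
    refine ((h1.const_sub 1).const_mul (C / B)).congr_deriv ?_
    field_simp
  have := image_norm_le_of_norm_deriv_right_le_deriv_boundary (f := g) (f' := g') (a := 0) (b := s)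
    (fun t ht => (hg t ht).continuousWithinAt)
    (fun t ht => ((hg t ⟨ht.1, ht.2.le⟩).mono_of_mem_nhdsWithin
      (mem_of_superset (Icc_mem_nhdsGE ht.2) (Icc_subset_Icc_left ht.1))))
    (B := fun t => C / B * (1 - Real.exp (-B * t))) (by simp [h0]) hv hbound ht
  refine this.trans ?_
  have h2 : C / B * (1 - Real.exp (-B * t)) ≤ C / B * 1 :=
    mul_le_mul_of_nonneg_left (by linarith [Real.exp_pos (-B * t)]) (by positivity)
  simpa using h2

end NegativeCurvature

/-! ### A metric and its conformal changes in charts -/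

section Manifold

open Topology Filter

variable {n : ℕ} {M : Type u} [TopologicalSpace M] [ChartedSpace (EuclideanSpace ℝ (Fin n)) M]

/-- The coordinate vector field `∂ᵢ` of a chart at the point with coordinates `y`. -/
noncomputable def coordVector (x₀ : M) (i : Fin n) (y : EuclideanSpace ℝ (Fin n)) :
    TangentSpace (𝓡 n) ((extChartAt (𝓡 n) x₀).symm y) :=
  mfderiv (𝓡 n) (𝓡 n) (extChartAt (𝓡 n) x₀).symm y
    (EuclideanSpace.single i (1 : ℝ) : EuclideanSpace ℝ (Fin n))

theorem metricMatrix_apply (g : BilinField n M) (x₀ : M) (y : EuclideanSpace ℝ (Fin n))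
    (i j : Fin n) : metricMatrix g x₀ y i j
      = g ((extChartAt (𝓡 n) x₀).symm y) (coordVector x₀ i y) (coordVector x₀ j y) := rfl

theorem contMDiffOn_coordVector [IsManifold (𝓡 n) ∞ M] (x₀ : M) (i : Fin n) :
    ContMDiffOn (𝓡 n) (𝓡 n).tangent ∞
      (fun y => (⟨(extChartAt (𝓡 n) x₀).symm y, coordVector x₀ i y⟩ : TangentBundle (𝓡 n) M))
      (extChartAt (𝓡 n) x₀).target := by
  have hopen := isOpen_extChartAt_target (I := 𝓡 n) x₀
  have h1 := (contMDiffOn_extChartAt_symm (n := ∞) (I := 𝓡 n) x₀).contMDiffOn_tangentMapWithin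
    (m := ∞) le_rfl hopen.uniqueMDiffOn
  have h2 : ContMDiffOn (𝓡 n) (𝓡 n).tangent ∞ (fun y : EuclideanSpace ℝ (Fin n) =>
      (⟨y, (EuclideanSpace.single i (1 : ℝ) : EuclideanSpace ℝ (Fin n))⟩ :
        TangentBundle (𝓡 n) (EuclideanSpace ℝ (Fin n)))) (extChartAt (𝓡 n) x₀).target :=
    contMDiffOn_vectorSpace_iff_contDiffOn.2 contDiffOn_const
  refine (h1.comp h2 fun y hy => hy).congr fun y hy => ?_
  simp only [coordVector, Function.comp_def, tangentMapWithin, mfderivWithin_of_isOpen hopen hy]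

theorem contDiffOn_metricMatrix [IsManifold (𝓡 n) ∞ M] (g : SmoothMetric n M) (x₀ : M)
    (i j : Fin n) : ContDiffOn ℝ ∞ (fun y => metricMatrix g.inner x₀ y i j)
      (extChartAt (𝓡 n) x₀).target := by
  rw [← contMDiffOn_iff_contDiffOn]
  intro y hy
  let _ : RiemannianBundle (fun x : M => TangentSpace (𝓡 n) x) := ⟨g.toRiemannianMetric⟩
  exact (contMDiffOn_coordVector x₀ i y hy).inner_bundle (contMDiffOn_coordVector x₀ j y hy)

theorem coordVector_sum_ne_zero [IsManifold (𝓡 n) ∞ M] (x₀ : M) {y : EuclideanSpace ℝ (Fin n)}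
    (hy : y ∈ (extChartAt (𝓡 n) x₀).target) {c : Fin n → ℝ} (hc : c ≠ 0) :
    ∑ i, c i • coordVector x₀ i y ≠ 0 := by
  have h := isInvertible_mfderivWithin_extChartAt_symm (I := 𝓡 n) hy
  rw [ModelWithCorners.range_eq_univ, mfderivWithin_univ] at h
  have hsum : ∑ i, c i • coordVector x₀ i y
      = mfderiv (𝓡 n) (𝓡 n) (extChartAt (𝓡 n) x₀).symm y (WithLp.toLp 2 c) := by
    have : (WithLp.toLp 2 c : EuclideanSpace ℝ (Fin n))
        = ∑ i, c i • EuclideanSpace.single i (1 : ℝ) := by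
      ext j
      simp [Finset.sum_apply, Pi.single_apply]
    rw [this]
    exact ((map_sum _ _ _).trans (Finset.sum_congr rfl fun i _ => map_smul _ _ _)).symm
  rw [hsum]
  intro h0
  have := h.injective (h0.trans (map_zero _).symm)
  have h2 : c = 0 := congrArg WithLp.ofLp this
  exact hc h2

theorem posDef_metricMatrix [IsManifold (𝓡 n) ∞ M] (g : SmoothMetric n M) (x₀ : M)
    {y : EuclideanSpace ℝ (Fin n)} (hy : y ∈ (extChartAt (𝓡 n) x₀).target) :
    (metricMatrix g.inner x₀ y).PosDef := by
  refine Matrix.PosDef.of_dotProduct_mulVec_pos ?_ fun c hc => ?_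
  · ext i j
    rw [Matrix.conjTranspose_apply, star_trivial, metricMatrix_apply, metricMatrix_apply, g.symm]
  · refine (g.pos _ _ (coordVector_sum_ne_zero x₀ hy hc)).trans_eq ?_
    simp only [dotProduct, Matrix.mulVec, metricMatrix_apply, star_trivial, map_sum, map_smul,
      _root_.sum_apply, smul_apply, smul_eq_mul, Finset.mul_sum]
    rw [Finset.sum_comm]
    exact Finset.sum_congr rfl fun i _ => Finset.sum_congr rfl fun j _ => by ring

theorem isMetricAt_metricMatrix [IsManifold (𝓡 n) ∞ M] (g : SmoothMetric n M) (x₀ : M)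
    {y : EuclideanSpace ℝ (Fin n)} (hy : y ∈ (extChartAt (𝓡 n) x₀).target) :
    IsMetricAt (metricMatrix g.inner x₀) y where
  contDiffAt i j := ((contDiffOn_metricMatrix g x₀ i j).contDiffAt
    ((isOpen_extChartAt_target x₀).mem_nhds hy)).of_le ENat.LEInfty.out
  posDef := by
    filter_upwards [(isOpen_extChartAt_target x₀).mem_nhds hy] with z hz
    exact posDef_metricMatrix g x₀ hz

theorem metricMatrix_conformal (g : BilinField n M) (φ : M → ℝ) (x₀ : M) :
    metricMatrix (conformal φ g) x₀ = fun y =>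
      (φ ((extChartAt (𝓡 n) x₀).symm y) ^ (4 / ((n : ℝ) - 2))) • metricMatrix g x₀ y := by
  funext y
  ext i j
  rw [Matrix.smul_apply, metricMatrix_apply, metricMatrix_apply]
  rfl

theorem contDiffAt_comp_extChartAt_symm [IsManifold (𝓡 n) ∞ M] {φ : M → ℝ}
    (hφ : ContMDiff (𝓡 n) 𝓘(ℝ, ℝ) 2 φ) (p : M) :
    ContDiffAt ℝ 2 (φ ∘ (extChartAt (𝓡 n) p).symm) (extChartAt (𝓡 n) p p) := by
  have h := (contMDiffAt_iff.1 (hφ p)).2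
  rw [ModelWithCorners.range_eq_univ, contDiffWithinAt_univ] at h
  exact h

/-- The conformal transformation law: the Yamabe equation on the manifold. -/
theorem scalarCurvature_conformal [IsManifold (𝓡 n) ∞ M] (hn : 3 ≤ n) (g : SmoothMetric n M)
    {φ : M → ℝ} (hφ : ContMDiff (𝓡 n) 𝓘(ℝ, ℝ) 2 φ) (hpos : ∀ p, 0 < φ p) (p : M) :
    scalarCurvature (conformal φ g.inner) p = φ p ^ (-(4 / ((n : ℝ) - 2))) *
      (scalarCurvature g.inner p - 4 * (n - 1) / (n - 2) * (laplacian g.inner φ p / φ p)) := by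
  have := (isMetricAt_metricMatrix g p (mem_extChartAt_target (I := 𝓡 n) p)).scalarCoord_rpow_smul
    hn (contDiffAt_comp_extChartAt_symm hφ p) fun z => hpos _
  rw [scalarCurvature, metricMatrix_conformal]
  simpa [scalarCurvature, laplacian] using this

/-- Comparison of the scalar curvatures of two conformal metrics at a point where the ratio of the
conformal factors is maximal. -/
theorem rpow_mul_scalarCurvature_le [IsManifold (𝓡 n) ∞ M] (hn : 3 ≤ n) (g : SmoothMetric n M)
    {φ ψ : M → ℝ} (hφ : ContMDiff (𝓡 n) 𝓘(ℝ, ℝ) 2 φ) (hψ : ContMDiff (𝓡 n) 𝓘(ℝ, ℝ) 2 ψ)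
    (hφpos : ∀ p, 0 < φ p) (hψpos : ∀ p, 0 < ψ p) {p : M} {r : ℝ} (hr : 0 < r)
    (hle : ∀ q, φ q ≤ r * ψ q) (hp : φ p = r * ψ p) :
    r ^ (-(4 / ((n : ℝ) - 2))) * scalarCurvature (conformal ψ g.inner) p
      ≤ scalarCurvature (conformal φ g.inner) p := by
  have hn2 : (0 : ℝ) < n - 2 := by
    have : (3 : ℝ) ≤ n := by exact_mod_cast hn
    linarith
  have hmetric := isMetricAt_metricMatrix g p (mem_extChartAt_target (I := 𝓡 n) p)
  have hφ' := contDiffAt_comp_extChartAt_symm hφ p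
  have hψ' := contDiffAt_comp_extChartAt_symm hψ p
  have hlap : laplacian g.inner φ p ≤ r * laplacian g.inner ψ p := by
    -- `r ψ - φ` has a minimum at `p`
    have h := hmetric.laplaceCoord_nonneg (F := fun z => r * (ψ ∘ (extChartAt (𝓡 n) p).symm) z
      - (φ ∘ (extChartAt (𝓡 n) p).symm) z) ((contDiffAt_const.mul hψ').sub hφ')
      (Eventually.of_forall fun z => by
        have h1 := hle ((extChartAt (𝓡 n) p).symm z)
        simp only [Function.comp, extChartAt_to_inv, hp]
        linarith)
    rw [laplaceCoord_const_mul_sub hψ' hφ'] at h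
    exact sub_nonneg.1 h
  rw [scalarCurvature_conformal hn g hφ hφpos, scalarCurvature_conformal hn g hψ hψpos, hp,
    Real.mul_rpow hr.le (hψpos p).le, mul_assoc]
  have h1 : laplacian g.inner φ p / (r * ψ p) ≤ laplacian g.inner ψ p / ψ p := by
    rw [div_le_div_iff₀ (mul_pos hr (hψpos p)) (hψpos p)]
    have := mul_le_mul_of_nonneg_right hlap (hψpos p).le
    linarith
  have h2 : 0 ≤ 4 * ((n : ℝ) - 1) / (n - 2) := div_nonneg (by linarith) hn2.le
  have h3 := mul_le_mul_of_nonneg_left h1 h2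
  have h4 := Real.rpow_pos_of_pos hr (-(4 / ((n : ℝ) - 2)))
  have h5 := Real.rpow_pos_of_pos (hψpos p) (-(4 / ((n : ℝ) - 2)))
  gcongr

end Manifold

/-! ### The volume measure -/

section Volume

open Topology

variable {n : ℕ} {M : Type u} [TopologicalSpace M] [ChartedSpace (EuclideanSpace ℝ (Fin n)) M]

/-- The part of the volume measure carried by one chart. -/
theorem chart_measure_univ [MeasurableSpace M] [BorelSpace M] (x : M)
    (F : EuclideanSpace ℝ (Fin n) → ℝ≥0∞) :
    ((((volume : Measure (EuclideanSpace ℝ (Fin n))).restrict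
      (extChartAt (𝓡 n) x).target).withDensity F).map (extChartAt (𝓡 n) x).symm) univ
      = ∫⁻ y in (extChartAt (𝓡 n) x).target, F y := by
  have hmeas : MeasurableSet (extChartAt (𝓡 n) x).target :=
    (isOpen_extChartAt_target (I := 𝓡 n) x).measurableSet
  have h : AEMeasurable (extChartAt (𝓡 n) x).symm
      ((volume : Measure (EuclideanSpace ℝ (Fin n))).restrict (extChartAt (𝓡 n) x).target) :=
    (continuousOn_extChartAt_symm (I := 𝓡 n) x).aemeasurable hmeas
  rw [Measure.map_apply_of_aemeasurable (h.mono_ac (withDensity_absolutelyContinuous _ _))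
    MeasurableSet.univ, preimage_univ, withDensity_apply _ MeasurableSet.univ,
    Measure.restrict_univ]

variable [IsManifold (𝓡 n) ∞ M]

theorem continuousOn_det_metricMatrix_conformal (g : SmoothMetric n M) {φ : M → ℝ}
    (hφ : Continuous φ) (hpos : ∀ p, 0 < φ p) (x : M) :
    ContinuousOn (fun y => (metricMatrix (conformal φ g.inner) x y).det)
      (extChartAt (𝓡 n) x).target := by
  rw [metricMatrix_conformal]
  simp only [Matrix.det_smul]
  refine ContinuousOn.mul (ContinuousOn.pow ?_ _) ?_
  · exact (hφ.comp_continuousOn (continuousOn_extChartAt_symm x)).rpow_const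
      fun y _ => Or.inl (hpos _).ne'
  · have h : ContinuousOn (metricMatrix g.inner x) (extChartAt (𝓡 n) x).target :=
      continuousOn_pi.2 fun i => continuousOn_pi.2 fun j =>
        (contDiffOn_metricMatrix g x i j).continuousOn
    exact (Continuous.matrix_det continuous_id).comp_continuousOn h

theorem det_metricMatrix_conformal_pos (g : SmoothMetric n M) {φ : M → ℝ} (hpos : ∀ p, 0 < φ p)
    (x : M) {y : EuclideanSpace ℝ (Fin n)} (hy : y ∈ (extChartAt (𝓡 n) x).target) :
    0 < (metricMatrix (conformal φ g.inner) x y).det := by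
  rw [metricMatrix_conformal]
  simp only [Matrix.det_smul]
  exact mul_pos (pow_pos (Real.rpow_pos_of_pos (hpos _) _) _) (posDef_metricMatrix g x hy).det_pos

variable [T2Space M] [CompactSpace M]

theorem chartPartition_isSubordinate (x : M) :
    tsupport (chartPartition n M x) ⊆ (chartAt (EuclideanSpace ℝ (Fin n)) x).source :=
  (SmoothPartitionOfUnity.exists_isSubordinate_chartAt_source (𝓡 n) M).choose_spec x

variable [MeasurableSpace M] [BorelSpace M]

theorem volumeMeasure_univ (g : BilinField n M) :
    volumeMeasure g univ = ∑' x : M, ∫⁻ y in (extChartAt (𝓡 n) x).target,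
      ENNReal.ofReal (chartPartition n M x ((extChartAt (𝓡 n) x).symm y) *
        √(metricMatrix g x y).det) := by
  rw [volumeMeasure, Measure.sum_apply _ MeasurableSet.univ]
  exact tsum_congr fun x => chart_measure_univ x _

/-- The volume is finite: by compactness finitely many partition functions are nonzero, and each has
compact support in its chart. -/
theorem isFiniteMeasure_volumeMeasure (g : BilinField n M)
    (hg : ∀ x : M, ContinuousOn (fun y => (metricMatrix g x y).det) (extChartAt (𝓡 n) x).target) :
    IsFiniteMeasure (volumeMeasure g) := by
  refine ⟨?_⟩
  rw [volumeMeasure_univ]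
  have hfin := (chartPartition n M).locallyFinite.finite_nonempty_of_compact
  rw [tsum_eq_sum (s := hfin.toFinset)]
  · refine ENNReal.sum_lt_top.2 fun x _ => ?_
    -- the integrand lives on the compact image `K` of the support of the partition function
    set K := extChartAt (𝓡 n) x '' tsupport (chartPartition n M x) with hK
    have hsub : tsupport (chartPartition n M x) ⊆ (extChartAt (𝓡 n) x).source := by
      rw [extChartAt_source]; exact chartPartition_isSubordinate x
    have hKc : IsCompact K :=
      (isClosed_tsupport _).isCompact.image_of_continuousOn ((continuousOn_extChartAt x).mono hsub)
    have hKt : K ⊆ (extChartAt (𝓡 n) x).target := by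
      rintro _ ⟨p, hp, rfl⟩
      exact (extChartAt (𝓡 n) x).map_source (hsub hp)
    obtain ⟨C, hC⟩ := hKc.exists_bound_of_continuousOn ((hg x).mono hKt).sqrt
    calc _ ≤ ∫⁻ y in (extChartAt (𝓡 n) x).target, K.indicator (fun _ => ENNReal.ofReal C) y := by
          refine setLIntegral_mono' (isOpen_extChartAt_target (I := 𝓡 n) x).measurableSet
            fun y hy => ?_
          by_cases hyK : y ∈ K
          · rw [indicator_of_mem hyK]
            refine ENNReal.ofReal_le_ofReal ?_
            have h1 := (chartPartition n M).le_one x ((extChartAt (𝓡 n) x).symm y)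
            have h2 := hC y hyK
            rw [Real.norm_eq_abs, abs_of_nonneg (Real.sqrt_nonneg _)] at h2
            exact (mul_le_of_le_one_left (Real.sqrt_nonneg _) h1).trans h2
          · have : chartPartition n M x ((extChartAt (𝓡 n) x).symm y) = 0 := by
              by_contra h0
              exact hyK ⟨_, subset_tsupport _ h0, (extChartAt (𝓡 n) x).right_inv hy⟩
            rw [this, zero_mul, ENNReal.ofReal_zero]
            exact zero_le
      _ ≤ ∫⁻ y, K.indicator (fun _ => ENNReal.ofReal C) y := setLIntegral_le_lintegral _ _
      _ = ENNReal.ofReal C * volume K := lintegral_indicator_const hKc.measurableSet _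
      _ < ⊤ := ENNReal.mul_lt_top ENNReal.ofReal_lt_top hKc.measure_lt_top
  · intro x hx
    have : ∀ p, chartPartition n M x p = 0 := by
      intro p
      by_contra h0
      exact hx (hfin.mem_toFinset.2 ⟨p, h0⟩)
    simp [this]

/-- The volume is positive: near a point where a partition function is positive its density is
bounded below on a nonempty open set. -/
theorem volumeMeasure_ne_zero [Nonempty M] (g : BilinField n M)
    (hg : ∀ x : M, ContinuousOn (fun y => (metricMatrix g x y).det) (extChartAt (𝓡 n) x).target)
    (hpos : ∀ x : M, ∀ y ∈ (extChartAt (𝓡 n) x).target, 0 < (metricMatrix g x y).det) :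
    volumeMeasure g ≠ 0 := by
  obtain ⟨p⟩ := ‹Nonempty M›
  obtain ⟨x, hx⟩ := (chartPartition n M).exists_pos_of_mem (mem_univ p)
  have hp : p ∈ (extChartAt (𝓡 n) x).source := by
    rw [extChartAt_source]
    exact chartPartition_isSubordinate x (subset_tsupport _ hx.ne')
  set y₀ := extChartAt (𝓡 n) x p
  have hy₀ : y₀ ∈ (extChartAt (𝓡 n) x).target := (extChartAt (𝓡 n) x).map_source hp
  have htn : (extChartAt (𝓡 n) x).target ∈ 𝓝 y₀ :=
    (isOpen_extChartAt_target (I := 𝓡 n) x).mem_nhds hy₀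
  have hc : ContinuousAt (fun y => chartPartition n M x ((extChartAt (𝓡 n) x).symm y) *
      √(metricMatrix g x y).det) y₀ := by
    refine ContinuousAt.mul ?_ ((hg x).continuousAt htn).sqrt
    exact ((chartPartition n M x).contMDiff.continuous.comp_continuousOn
      (continuousOn_extChartAt_symm x)).continuousAt htn
  have hval : 0 < chartPartition n M x ((extChartAt (𝓡 n) x).symm y₀) *
      √(metricMatrix g x y₀).det := by
    rw [(extChartAt (𝓡 n) x).left_inv hp]
    exact mul_pos hx (Real.sqrt_pos.2 (hpos x y₀ hy₀))
  obtain ⟨c, hc0, hcv⟩ := exists_between hval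
  obtain ⟨U, hU, hUo, hyU⟩ := mem_nhds_iff.1 ((hc.eventually (lt_mem_nhds hcv)).and htn)
  intro h0
  have h1 : volumeMeasure g univ = 0 := by rw [h0]; rfl
  rw [volumeMeasure_univ, ENNReal.tsum_eq_zero] at h1
  have h2 : ENNReal.ofReal c * volume U ≤ 0 := by
    rw [← h1 x, ← setLIntegral_const]
    refine (setLIntegral_mono' hUo.measurableSet fun y hy => ?_).trans
      (lintegral_mono_set fun y hy => (hU hy).2)
    exact ENNReal.ofReal_le_ofReal (hU hy).1.le
  have h3 : 0 < ENNReal.ofReal c * volume U :=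
    ENNReal.mul_pos (ENNReal.ofReal_pos.2 hc0).ne' (hUo.measure_pos _ ⟨y₀, hyU⟩).ne'
  exact absurd h3 (not_lt.2 h2)

/-- The average lies between the extreme values. The total volume is positive and finite, so that
it is a genuine average. -/
theorem exists_averageCurvature_le_and_ge [Nonempty M] {f : ℝ → ℝ} (g : SmoothMetric n M)
    {φ : M → ℝ} (hφ : Continuous φ) (hpos : ∀ p, 0 < φ p)
    (hS : Continuous fun p => f (scalarCurvature (conformal φ g.inner) p)) :
    (∃ p, averageCurvature f (conformal φ g.inner)
      ≤ f (scalarCurvature (conformal φ g.inner) p)) ∧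
    ∃ p, f (scalarCurvature (conformal φ g.inner) p)
      ≤ averageCurvature f (conformal φ g.inner) := by
  have hdet := continuousOn_det_metricMatrix_conformal g hφ hpos
  have := isFiniteMeasure_volumeMeasure _ hdet
  have hne := volumeMeasure_ne_zero _ hdet fun x y hy => det_metricMatrix_conformal_pos g hpos x hy
  have hint : Integrable (fun p => f (scalarCurvature (conformal φ g.inner) p))
      (volumeMeasure (conformal φ g.inner)) :=
    hS.integrable_of_hasCompactSupport (HasCompactSupport.of_compactSpace _)
  exact ⟨exists_average_le hne hint, exists_le_average hne hint⟩

end Volume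

/-! ### Solutions of the generalized Yamabe flow -/

section Solution

open Topology

variable {n : ℕ} {M : Type u} [TopologicalSpace M] [ChartedSpace (EuclideanSpace ℝ (Fin n)) M]
  [IsManifold (𝓡 n) ∞ M] [T2Space M] [CompactSpace M] [MeasurableSpace M]
  {f : ℝ → ℝ} {g₀ : SmoothMetric n M} {α : ℝ} {T : EReal} {u : ℝ → M → ℝ}

theorem Icc_subset_timeInterval {τ : ℝ} (hτ : τ ∈ timeInterval T) : Icc 0 τ ⊆ timeInterval T :=
  fun _ ht => ⟨ht.1, (EReal.coe_le_coe_iff.2 ht.2).trans_lt hτ.2⟩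

theorem exists_gt_mem_timeInterval {t : ℝ} (ht : t ∈ timeInterval T) :
    ∃ τ ∈ timeInterval T, t < τ := by
  obtain ⟨τ, h1, h2⟩ := EReal.lt_iff_exists_real_btwn.1 ht.2
  have h1' : t < τ := EReal.coe_lt_coe_iff.1 h1
  exact ⟨τ, ⟨ht.1.trans h1'.le, h2⟩, h1'⟩

namespace IsYamabeSolution

/-- The flow equation for the logarithm of the conformal factor. -/
theorem hasDerivWithinAt_log (hn : 3 ≤ n) (H : IsYamabeSolution f g₀ α T u) {t : ℝ}
    (ht : t ∈ timeInterval T) (p : M) :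
    HasDerivWithinAt (fun s => 4 / ((n : ℝ) - 2) * Real.log (u s p))
      (f (scalarCurvature (conformal (u t) g₀.inner) p)
        - averageCurvature f (conformal (u t) g₀.inner)) (timeInterval T) t := by
  have : Nontrivial (TangentSpace (𝓡 n) p) := by
    have : Nonempty (Fin n) := ⟨⟨0, by omega⟩⟩
    exact inferInstanceAs (Nontrivial (EuclideanSpace ℝ (Fin n)))
  -- evaluate the flow equation on a nonzero vector
  obtain ⟨v, hv⟩ := exists_ne (0 : TangentSpace (𝓡 n) p)
  have hg := g₀.pos p v hv
  have hd := H.flow t ht p v v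
  have hc : ∀ s, conformal (u s) g₀.inner p v v
      = u s p ^ (4 / ((n : ℝ) - 2)) * g₀.inner p v v := fun s => rfl
  simp only [hc] at hd
  have hpow : 0 < u t p ^ (4 / ((n : ℝ) - 2)) := Real.rpow_pos_of_pos (H.pos t ht p) _
  have hlog := hd.log (mul_pos hpow hg).ne'
  rw [mul_div_cancel_right₀ _ (mul_pos hpow hg).ne'] at hlog
  refine (hlog.sub_const (Real.log (g₀.inner p v v))).congr_of_mem (fun s hs => ?_) ht
  rw [Real.log_mul (Real.rpow_pos_of_pos (H.pos s hs p) _).ne' hg.ne',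
    Real.log_rpow (H.pos s hs p), add_sub_cancel_right]

theorem conformal_zero (H : IsYamabeSolution f g₀ α T u) :
    conformal (u 0) g₀.inner = g₀.inner := by
  funext p
  simp [conformal, H.initial p]

/-- The right hand side of the flow equation is jointly continuous in time and space, because it is
`4/(n-2) ∂ₜu / u`. -/
theorem continuousOn_speed (hn : 3 ≤ n) (H : IsYamabeSolution f g₀ α T u) {τ : ℝ} (hτ0 : 0 < τ)
    (hτ : τ ∈ timeInterval T) :
    ContinuousOn (fun z : ℝ × M => f (scalarCurvature (conformal (u z.1) g₀.inner) z.2)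
      - averageCurvature f (conformal (u z.1) g₀.inner)) (Icc 0 τ ×ˢ univ) := by
  obtain ⟨-, hu, -, u', hu', hd⟩ := H.regular τ hτ
  have hsub := Icc_subset_timeInterval hτ
  refine (((hu'.1.div hu.1 fun z hz => (H.pos z.1 (hsub hz.1) z.2).ne').const_smul
    (4 / ((n : ℝ) - 2)))).congr fun z hz => ?_
  have h1 := (H.hasDerivWithinAt_log hn (hsub hz.1) z.2).mono hsub
  have h2 := ((hd z.1 hz.1 z.2).log (H.pos z.1 (hsub hz.1) z.2).ne').const_mul (4 / ((n : ℝ) - 2))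
  exact (uniqueDiffOn_Icc hτ0 z.1 hz.1).eq_deriv _ h1 h2

/-- The initial scalar curvature is continuous: at time zero the flow equation exhibits its image
under `f` as a continuous function, and `f` is injective on its range. This replaces a comparison of
the scalar curvatures computed in different charts. -/
theorem continuous_initial (hn : 3 ≤ n) (H : IsYamabeSolution f g₀ α T u) (hf : Continuous f)
    {a b : ℝ} (hdecr : ∀ x ∈ Icc a b, deriv f x < 0) (hT : 0 < T)
    (h0 : ∀ p, scalarCurvature g₀.inner p ∈ Icc a b) :
    Continuous (scalarCurvature g₀.inner) := by
  obtain ⟨τ, hτ, hτ0⟩ := exists_gt_mem_timeInterval (t := 0) (T := T) ⟨le_rfl, by simpa using hT⟩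
  have hanti : StrictAntiOn f (Icc a b) := strictAntiOn_of_deriv_neg (convex_Icc _ _)
    hf.continuousOn fun x hx => hdecr x (interior_subset hx)
  have hfS : Continuous fun p => f (scalarCurvature g₀.inner p) := by
    have h1 : Continuous fun p => f (scalarCurvature (conformal (u 0) g₀.inner) p)
        - averageCurvature f (conformal (u 0) g₀.inner) :=
      (H.continuousOn_speed hn hτ0 hτ).comp_continuous (f := fun p : M => ((0 : ℝ), p))
        (by fun_prop) fun p => ⟨⟨le_rfl, hτ0.le⟩, mem_univ _⟩
    have h2 := h1.add_const (averageCurvature f (conformal (u 0) g₀.inner))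
    simpa only [sub_add_cancel, H.conformal_zero] using h2
  have hemb : IsClosedEmbedding fun x : Icc a b => f x :=
    (hf.comp continuous_subtype_val).isClosedEmbedding hanti.injOn.injective
  have h3 : Continuous fun p => (⟨scalarCurvature g₀.inner p, h0 p⟩ : Icc a b) :=
    hemb.isEmbedding.continuous_iff.2 hfS
  exact continuous_subtype_val.comp h3

/-- A solution of the generalized Yamabe flow satisfies the hypotheses of the abstract estimates. -/
theorem curvatureFlow [BorelSpace M] [Nonempty M] (hn : 3 ≤ n) (H : IsYamabeSolution f g₀ α T u)
    (hf : Continuous f) (hS₀ : Continuous (scalarCurvature g₀.inner)) {τ : ℝ} (hτ0 : 0 < τ)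
    (hτ : τ ∈ timeInterval T) :
    CurvatureFlow τ f (fun t => averageCurvature f (conformal (u t) g₀.inner))
      (fun t p => 4 / ((n : ℝ) - 2) * Real.log (u t p))
      (fun t p => scalarCurvature (conformal (u t) g₀.inner) p) := by
  obtain ⟨hC2, hu, hΔ, -⟩ := H.regular τ hτ
  have hsub := Icc_subset_timeInterval hτ
  have hn2 : (0 : ℝ) < n - 2 := by
    have : (3 : ℝ) ≤ n := by exact_mod_cast hn
    linarith
  have he : 0 < 4 / ((n : ℝ) - 2) := by positivity
  have hne : ∀ z ∈ Icc 0 τ ×ˢ (univ : Set M), u z.1 z.2 ≠ 0 := fun z hz =>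
    (H.pos z.1 (hsub hz.1) z.2).ne'
  have hS : ContinuousOn (fun z : ℝ × M => scalarCurvature (conformal (u z.1) g₀.inner) z.2)
      (Icc 0 τ ×ˢ univ) := by
    refine ((hu.1.rpow_const (p := -(4 / ((n : ℝ) - 2))) fun z hz => Or.inl (hne z hz)).mul
      ((hS₀.comp continuous_snd).continuousOn.sub
        ((hΔ.1.div hu.1 hne).const_smul (4 * ((n : ℝ) - 1) / (n - 2))))).congr fun z hz => ?_
    exact scalarCurvature_conformal hn g₀ (hC2 z.1 hz.1) (H.pos z.1 (hsub hz.1)) z.2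
  have hslice : ∀ t ∈ Icc 0 τ, Continuous (scalarCurvature (conformal (u t) g₀.inner)) :=
    fun t ht => hS.comp_continuous (f := fun p : M => (t, p)) (by fun_prop)
      fun p => ⟨ht, mem_univ _⟩
  have havg := fun t ht => exists_averageCurvature_le_and_ge g₀ (hC2 t ht).continuous
    (H.pos t (hsub ht)) (hf.comp (hslice t ht))
  constructor
  · exact (hu.1.log hne).const_smul (4 / ((n : ℝ) - 2))
  · exact hS
  · -- `A` is the difference of the continuous functions `f(S)` and `f(S) - A` at a fixed point
    obtain ⟨p⟩ := ‹Nonempty M›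
    have h1 := (hf.comp_continuousOn hS).sub (H.continuousOn_speed hn hτ0 hτ)
    refine (h1.comp (f := fun t : ℝ => (t, p)) (by fun_prop)
      fun t ht => ⟨ht, mem_univ _⟩).congr fun t ht => ?_
    exact (sub_sub_cancel _ _).symm
  · exact fun t ht p => (H.hasDerivWithinAt_log hn (hsub ht) p).mono hsub
  · exact fun t ht => (havg t ht).1
  · exact fun t ht => (havg t ht).2
  · -- the conformal factors compare with the ratio `r` for which `r^{4/(n-2)} = e^d`
    intro t ht t' ht' p hmax
    set d := 4 / ((n : ℝ) - 2) * Real.log (u t' p) - 4 / ((n : ℝ) - 2) * Real.log (u t p) with hd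
    have hpos := H.pos t (hsub ht)
    have hpos' := H.pos t' (hsub ht')
    have hlog : ∀ q, Real.log (Real.exp (d / (4 / ((n : ℝ) - 2))) * u t q)
        = d / (4 / ((n : ℝ) - 2)) + Real.log (u t q) := fun q => by
      rw [Real.log_mul (Real.exp_pos _).ne' (hpos q).ne', Real.log_exp]
    have h := rpow_mul_scalarCurvature_le hn g₀ (hC2 t' ht') (hC2 t ht) hpos' hpos
      (p := p) (Real.exp_pos (d / (4 / ((n : ℝ) - 2)))) (fun q => ?_) ?_
    · rw [← Real.exp_mul] at h
      convert h using 3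
      field_simp
    · rw [← Real.log_le_log_iff (hpos' q) (mul_pos (Real.exp_pos _) (hpos q)), hlog,
        ← sub_le_iff_le_add, le_div_iff₀ he]
      have := hmax q
      linarith
    · refine Real.log_injOn_pos (hpos' p) (mul_pos (Real.exp_pos _) (hpos p)) ?_
      rw [hlog, hd, ← mul_sub, mul_div_cancel_left₀ _ he.ne']
      ring

end IsYamabeSolution

end Solution

end YamabeFlow

theorem mainTheorem6 (n : ℕ) (hn : 3 ≤ n) (f : ℝ → ℝ) (hf : ContDiff ℝ 2 f)
    (S₀min S₀max : ℝ) (hneg : S₀max < 0)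
    (hdecr : ∀ x ∈ Set.Icc S₀min S₀max, deriv f x < 0) :
    ∃ B C c : ℝ, 0 < B ∧ 0 < C ∧ 0 < c ∧
      ∀ (M : Type*) [TopologicalSpace M] [ChartedSpace (EuclideanSpace ℝ (Fin n)) M]
        [IsManifold (𝓡 n) ∞ M] [T2Space M] [CompactSpace M] [MeasurableSpace M] [BorelSpace M]
        (g₀ : YamabeFlow.SmoothMetric n M),
        IsLeast (Set.range (YamabeFlow.scalarCurvature g₀.inner)) S₀min →
        IsGreatest (Set.range (YamabeFlow.scalarCurvature g₀.inner)) S₀max →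
        ∀ (α : ℝ), 0 < α → α < 1 → ∀ (T : EReal), 0 < T → ∀ (u : ℝ → M → ℝ),
          YamabeFlow.IsYamabeSolution f g₀ α T u →
          ∀ t ∈ YamabeFlow.timeInterval T,
            (∀ p, |f (YamabeFlow.scalarCurvature (YamabeFlow.conformal (u t) g₀.inner) p)
                - YamabeFlow.averageCurvature f (YamabeFlow.conformal (u t) g₀.inner)|
              ≤ C * Real.exp (-B * t)) ∧
            ∀ p, c⁻¹ ≤ u t p ∧ u t p ≤ c := by
  rcases lt_or_ge S₀max S₀min with hab | hab
  · -- no manifold has such curvature bounds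
    refine ⟨1, 1, 1, one_pos, one_pos, one_pos, ?_⟩
    intro M _ _ _ _ _ _ _ g₀ hmin hmax
    exact absurd (hmax.2 hmin.1) (not_le.2 hab)
  have hcd : Continuous (deriv f) := hf.continuous_deriv (by norm_num)
  -- the rate `B` is the minimum of `f'(x) x`, the slope of `σ ↦ f(-e^σ)`
  obtain ⟨x₀, hx₀, hB⟩ := (isCompact_Icc (a := S₀min) (b := S₀max)).exists_isMinOn
    (nonempty_Icc.2 hab) (hcd.mul continuous_id).continuousOn
  set B : ℝ := deriv f x₀ * x₀ with hBdef
  have hBpos : 0 < B := mul_pos_of_neg_of_neg (hdecr x₀ hx₀) (hx₀.2.trans_lt hneg)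
  have hslope : ∀ x ∈ Icc S₀min S₀max, B ≤ deriv f x * x := fun x hx => hB hx
  have hanti : AntitoneOn f (Icc S₀min S₀max) :=
    (strictAntiOn_of_deriv_neg (convex_Icc _ _) hf.continuous.continuousOn
      fun x hx => hdecr x (interior_subset hx)).antitoneOn
  have hosc : 0 ≤ f S₀min - f S₀max :=
    sub_nonneg.2 (hanti (left_mem_Icc.2 hab) (right_mem_Icc.2 hab) hab)
  have hn2 : (0 : ℝ) < n - 2 := by
    have : (3 : ℝ) ≤ n := by exact_mod_cast hn
    linarith
  have he : 0 < 4 / ((n : ℝ) - 2) := by positivity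
  -- the oscillation of `f` may vanish, but `C` has to be positive
  set C : ℝ := f S₀min - f S₀max + 1 with hC
  have hCpos : 0 < C := by linarith
  refine ⟨B, C, Real.exp (C / B / (4 / ((n : ℝ) - 2))), hBpos, hCpos, Real.exp_pos _, ?_⟩
  intro M _ _ _ _ _ _ _ g₀ hmin hmax α _ _ T hT u H t ht
  obtain ⟨p₀, -⟩ := hmin.1
  have : Nonempty M := ⟨p₀⟩
  have hrange : ∀ p, YamabeFlow.scalarCurvature g₀.inner p ∈ Icc S₀min S₀max := fun p =>
    ⟨hmin.2 (mem_range_self p), hmax.2 (mem_range_self p)⟩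
  have hS₀ := H.continuous_initial hn hf.continuous hdecr hT hrange
  obtain ⟨τ, hτ, htτ⟩ := YamabeFlow.exists_gt_mem_timeInterval ht
  have hflow := H.curvatureFlow hn hf.continuous hS₀ (ht.1.trans_lt htτ) hτ
  have hdecay : ∀ s ∈ Ico 0 τ, ∀ p,
      |f (YamabeFlow.scalarCurvature (YamabeFlow.conformal (u s) g₀.inner) p)
        - YamabeFlow.averageCurvature f (YamabeFlow.conformal (u s) g₀.inner)|
      ≤ C * Real.exp (-B * s) := fun s hs p =>
    (hflow.abs_sub_le hf hab hneg hdecr hBpos.le hslope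
      (by simpa only [H.conformal_zero] using hrange) hs p).trans
      (mul_le_mul_of_nonneg_right (by linarith) (Real.exp_pos _).le)
  refine ⟨hdecay t ⟨ht.1, htτ⟩, fun p => ?_⟩
  have hw := YamabeFlow.abs_le_of_abs_deriv_le_exp hBpos hCpos.le
    (fun s hs => hflow.hasDeriv s hs p) (by simp [H.initial p]) (fun s hs => hdecay s hs p)
    (t := t) ⟨ht.1, htτ.le⟩
  rw [abs_mul, abs_of_pos he, mul_comm, ← le_div_iff₀ he, abs_le] at hw
  have hupos := H.pos t ht p
  rw [← Real.exp_neg, ← Real.exp_log hupos, Real.exp_le_exp, Real.exp_le_exp]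
  exact hw
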